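/- Let $\mathbb{Q}_{\mathbb{C}}$ be the algebra of complexified quaternions $q=s+x\mathbf{i}+y\mathbf{j}+z\mathbf{k}$ with $s,x,y,z\in\mathbb{C}$, with conjugation $q^{*}=s-x\mathbf{i}-y\mathbf{j}-z\mathbf{k}$. For an $n\times n$ matrix $X$ over $\mathbb{Q}_{\mathbb{C}}$ let $$\mathrm{Det}_{M}(X)=\sum_{\sigma\in S_n}\varepsilon(\sigma)\,(X_{n_1i_2}X_{i_2i_3}\cdots X_{i_sn_1})\cdots(X_{n_rk_2}\cdots X_{k_ln_r})$$ be its Moore–Dyson determinant. Here $\varepsilon(\sigma)$ is the sign of $\sigma$, and $\sigma=(n_1i_2\ldots i_s)\cdots(n_rk_2\ldots k_l)$ is written as a product of cycles, fixed points included, in which each $n_j$ is the largest element of its cycle and $n_1>\dots>n_r$. Let $\Lambda$ be a measurable space that also carries a topology (used only to say what "locally" means), and let $\mu$ be a $\sigma$-finite measure on $\Lambda$. A random point field on $\Lambda$ is a probability measure on the space of countable configurations of points of $\Lambda$ (counted with multiplicity) with finitely many points in every compact set. It is Pfaffian with kernel $K:\Lambda\times\Lambda\to\mathbb{Q}_{\mathbb{C}}$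 if $K(y,x)=K(x,y)^{*}$ for all $x,y$ and, for every $m\ge 1$, the function $R_m(x_1,\dots,x_m)=\mathrm{Det}_M(K(x_i,x_j))_{1\le i,j\le m}$ is a nonnegative, locally integrable $m$-point correlation function of the field with respect to $\mu$. The last condition means that for all disjoint measurable $A_1,\dots,A_p\subset\Lambda$ and all integers $k_i\ge 0$ with $\sum_i k_i=m$, $$\mathbb{E}\prod_{i=1}^{p}\bigl[\#(A_i)(\#(A_i)-1)\cdots(\#(A_i)-k_i+1)\bigr]=\int_{A_1^{k_1}\times\cdots\times A_p^{k_p}}R_m\,d\mu^{\otimes m}.$$ Let $K(x,y)=\sum_{k=1}^{r}\lambda_k u_k(x)u_k^{*}(y)$ for all $x,y\in\Lambda$, where $r<\infty$, $\lambda_k\in[0,1]$ for all $k$, and $u_1,\dots,u_r:\Lambda\to\mathbb{Q}_{\mathbb{C}}$ are measurable and orthonormal, that is, $\int_\Lambda u_k^{*}u_l\,d\mu=\delta_{kl}$ (the integrands being integrable). Suppose that $K$ is completely positive: for every $I\subseteq\{1,\dots,r\}$ the kernel $K_I(x,y)=\sum_{i\in I}u_i(x)u_i^{*}(y)$ satisfies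 $\mathrm{Det}_M(K_I(x_i,x_j))_{1\le i,j\le m}\ge 0$ for all $m\ge 1$ and all $x_1,\dots,x_m\in\Lambda$. Let $\xi_1,\dots,\xi_r$ be independent Bernoulli random variables, $\xi_k=1$ with probability $\lambda_k$ and $\xi_k=0$ with probability $1-\lambda_k$, and let $$K_\xi(x,y)=\sum_{k=1}^{r}\xi_k u_k(x)u_k^{*}(y).$$ Then there is a mixture $\mathcal{X}_\xi$ of Pfaffian point fields with the random kernels $K_\xi$, that is, a random point field which, conditionally on the randomness of $\xi$, is almost surely a Pfaffian point field with kernel $K_\xi$. Every such mixture $\mathcal{X}_\xi$ is a Pfaffian point field with kernel $K$. -/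

import Mathlib

open MeasureTheory ProbabilityTheory
open scoped ENNReal NNReal Quaternion

noncomputable section

namespace Pfaffian

/-! ### The Moore-Dyson determinant -/

/-- The product `X a (σ a) * X (σ a) (σ² a) * ⋯ * X (σˢ⁻¹ a) a` along the cycle of `σ` through `a`
(a fixed point `a` contributes `X a a`). -/
def cycleProd {R : Type*} [Ring R] {n : ℕ} (X : Matrix (Fin n) (Fin n) R)
    (σ : Equiv.Perm (Fin n)) (a : Fin n) : R :=
  ((List.range (Function.minimalPeriod σ a)).map
    fun t => X ((σ ^ t) a) ((σ ^ (t + 1)) a)).prod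

open scoped Classical in
/-- The largest elements of the cycles of `σ` (fixed points included), in decreasing order. -/
def cycleLeaders {n : ℕ} (σ : Equiv.Perm (Fin n)) : List (Fin n) :=
  (List.finRange n).reverse.filter fun a => ∀ b, σ.SameCycle a b → b ≤ a

/-- The Moore-Dyson determinant: the signed sum over all permutations of the product of the
cycle products, each cycle starting at its largest element and the cycles being
ordered by decreasing largest element. -/
def detM {R : Type*} [Ring R] {n : ℕ} (X : Matrix (Fin n) (Fin n) R) : R :=
  ∑ σ : Equiv.Perm (Fin n),
    ((Equiv.Perm.sign σ : ℤˣ) : ℤ) • ((cycleLeaders σ).map (cycleProd X σ)).prod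

/-! ### Complexified quaternions

Complexified quaternions are `ℍ[ℂ]`. The conjugation `star` negates the three imaginary
components and does not conjugate the complex coefficients. -/

/-- Measurability of a quaternion function (all four coefficients). -/
def QMeasurable {Λ : Type*} [MeasurableSpace Λ] (f : Λ → ℍ[ℂ]) : Prop :=
  Measurable (fun x => (f x).re) ∧ Measurable (fun x => (f x).imI) ∧
    Measurable (fun x => (f x).imJ) ∧ Measurable (fun x => (f x).imK)

/-- Integrability of a quaternion function (all four coefficients). -/
def QIntegrable {Λ : Type*} [MeasurableSpace Λ] (f : Λ → ℍ[ℂ]) (μ : Measure Λ) : Prop :=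
  Integrable (fun x => (f x).re) μ ∧ Integrable (fun x => (f x).imI) μ ∧
    Integrable (fun x => (f x).imJ) μ ∧ Integrable (fun x => (f x).imK) μ

/-- The coefficientwise integral of a quaternion function. -/
def qIntegral {Λ : Type*} [MeasurableSpace Λ] (f : Λ → ℍ[ℂ]) (μ : Measure Λ) : ℍ[ℂ] :=
  ⟨∫ x, (f x).re ∂μ, ∫ x, (f x).imI ∂μ, ∫ x, (f x).imJ ∂μ, ∫ x, (f x).imK ∂μ⟩

/-- A real number as a complexified quaternion. -/
def ofRealQ (a : ℝ) : ℍ[ℂ] := ((a : ℂ) : ℍ[ℂ])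

/-- The matrix `(K (x i) (x j))`. -/
def kernelMatrix {Λ : Type*} (K : Λ → Λ → ℍ[ℂ]) {m : ℕ} (x : Fin m → Λ) :
    Matrix (Fin m) (Fin m) ℍ[ℂ] :=
  Matrix.of fun i j => K (x i) (x j)

/-- A kernel is positive if all determinants `detM (K (x i) (x j))` are nonnegative reals. -/
def IsPositiveKernel {Λ : Type*} (K : Λ → Λ → ℍ[ℂ]) : Prop :=
  ∀ (m : ℕ) (x : Fin m → Λ), 1 ≤ m → ∃ a : ℝ, 0 ≤ a ∧ detM (kernelMatrix K x) = ofRealQ a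

/-- The system `u` of quaternion functions is orthonormal: `∫ u_k^* u_l dμ = δ_{kl}`. -/
structure IsOrthonormalSystem {Λ : Type*} [MeasurableSpace Λ] (μ : Measure Λ) {r : ℕ}
    (u : Fin r → Λ → ℍ[ℂ]) : Prop where
  measurable : ∀ k, QMeasurable (u k)
  integrable : ∀ k l, QIntegrable (fun x => star (u k x) * u l x) μ
  integral_eq : ∀ k l, qIntegral (fun x => star (u k x) * u l x) μ = if k = l then 1 else 0

/-- The kernel `∑ k, c_k u_k(x) u_k(y)^*`. -/
def diagKernel {Λ : Type*} {r : ℕ} (c : Fin r → ℝ) (u : Fin r → Λ → ℍ[ℂ]) (x y : Λ) : ℍ[ℂ] :=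
  ∑ k, ofRealQ (c k) * (u k x * star (u k y))

/-- `K` has the finite-rank quasi-real diagonal form with real eigenvalues `c` and
orthonormal eigenfunctions `u`. -/
structure HasQuasiRealForm {Λ : Type*} [MeasurableSpace Λ] (μ : Measure Λ)
    (K : Λ → Λ → ℍ[ℂ]) {r : ℕ} (c : Fin r → ℝ) (u : Fin r → Λ → ℍ[ℂ]) : Prop where
  orthonormal : IsOrthonormalSystem μ u
  eq_sum : ∀ x y, K x y = diagKernel c u x y

/-- Complete positivity: each kernel `K_I(x, y) = ∑ i ∈ I, u_i(x) u_i(y)^*` is positive. -/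
def IsCompletelyPositive {Λ : Type*} {r : ℕ} (u : Fin r → Λ → ℍ[ℂ]) : Prop :=
  ∀ I : Finset (Fin r), IsPositiveKernel fun x y => ∑ i ∈ I, u i x * star (u i y)

/-! ### Random point fields

The topology of `Λ` only says what is local: configurations are finite on compact sets, and
correlation functions are locally integrable. It need not be related to the σ-algebra of `Λ`, so
the definitions cover both Borel σ-algebras and plain measurable spaces. -/

/-- A configuration: countably many points of `Λ`, counted with multiplicity, finitely many in
every compact set. -/
structure Configuration (Λ : Type*) [TopologicalSpace Λ] where
  mult : Λ → ℕ
  countable_support : (Function.support mult).Countable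
  finite_inter : ∀ C : Set Λ, IsCompact C → (C ∩ Function.support mult).Finite

/-- The number of points (with multiplicity) of a configuration in the set `A`. -/
def Configuration.count {Λ : Type*} [TopologicalSpace Λ] (A : Set Λ) (X : Configuration Λ) :
    ℝ≥0∞ :=
  ∑' x : A, (X.mult x : ℝ≥0∞)

/-- The σ-algebra on configurations generated by the numbers of points in measurable sets. -/
instance Configuration.instMeasurableSpace {Λ : Type*} [TopologicalSpace Λ] [MeasurableSpace Λ] :
    MeasurableSpace (Configuration Λ) :=
  ⨆ (A : Set Λ) (_ : MeasurableSet A),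
    MeasurableSpace.comap (Configuration.count A) inferInstance

/-- The falling factorial `n (n - 1) ⋯ (n - k + 1)` of a number of points `n ∈ {0, 1, …, ∞}`. -/
def fallingFactorial (n : ℝ≥0∞) (k : ℕ) : ℝ≥0∞ :=
  ∏ j ∈ Finset.range k, (n - (j : ℝ≥0∞))

/-- `R` is a `k`-point correlation function of the random point field `P` with respect to `μ`.
The disjoint sets are `A 0, …, A (m - 1)`. The nondecreasing map `b` says in which of them each of
the `k` coordinates lies, so `k_i` is the number of `j` with `b j = i`, and
the domain of integration is `A_0^{k_0} × ⋯ × A_{m-1}^{k_{m-1}}`. -/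
structure IsCorrelationFunction {Λ : Type*} [TopologicalSpace Λ] [MeasurableSpace Λ]
    (P : Measure (Configuration Λ)) (μ : Measure Λ) (k : ℕ) (R : (Fin k → Λ) → ℝ≥0) : Prop where
  aemeasurable : AEMeasurable R (Measure.pi fun _ => μ)
  locallyIntegrable : LocallyIntegrable (fun x => (R x : ℝ)) (Measure.pi fun _ => μ)
  moments : ∀ (m : ℕ) (A : Fin m → Set Λ), (∀ i, MeasurableSet (A i)) →
    Pairwise (Function.onFun Disjoint A) → ∀ b : Fin k → Fin m, Monotone b →
    ∫⁻ X, ∏ i, fallingFactorial (X.count (A i)) (Finset.univ.filter fun j => b j = i).card ∂P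
      = ∫⁻ x in {x : Fin k → Λ | ∀ j, x j ∈ A (b j)}, (R x : ℝ≥0∞) ∂(Measure.pi fun _ => μ)

/-- `P` is (the law of) a Pfaffian random point field with the self-dual quaternion kernel `K`. -/
structure IsPfaffianField {Λ : Type*} [TopologicalSpace Λ] [MeasurableSpace Λ]
    (P : Measure (Configuration Λ)) (μ : Measure Λ) (K : Λ → Λ → ℍ[ℂ]) : Prop where
  isProbabilityMeasure : IsProbabilityMeasure P
  selfDual : ∀ x y, K y x = star (K x y)
  correlation : ∀ m : ℕ, 1 ≤ m → ∃ R : (Fin m → Λ) → ℝ≥0,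
    IsCorrelationFunction P μ m R ∧ ∀ x, ofRealQ (R x : ℝ) = detM (kernelMatrix K x)

/-- The `ξ_k` are independent Bernoulli random variables, `ξ_k = 1` with probability `c_k` and
`ξ_k = 0` with probability `1 - c_k`. -/
structure IsBernoulliFamily {Ω : Type*} [MeasurableSpace Ω] (ν : Measure Ω) {r : ℕ}
    (c : Fin r → ℝ) (ξ : Fin r → Ω → ℝ) : Prop where
  measurable : ∀ k, Measurable (ξ k)
  indep : iIndepFun ξ ν
  prob_one : ∀ k, ν {ω | ξ k ω = 1} = ENNReal.ofReal (c k)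
  prob_zero : ∀ k, ν {ω | ξ k ω = 0} = ENNReal.ofReal (1 - c k)

/-- Conditionally on `ω`, the field has law `κ ω`, and `κ ω` is almost surely a Pfaffian field
with the random kernel `K_ξ(x, y) = ∑ k, ξ_k u_k(x) u_k(y)^*`. The mixture itself has the
law `ν.bind κ`. -/
def IsPfaffianMixture {Λ Ω : Type*} [TopologicalSpace Λ] [MeasurableSpace Λ] [MeasurableSpace Ω]
    (μ : Measure Λ) (ν : Measure Ω) {r : ℕ} (u : Fin r → Λ → ℍ[ℂ]) (ξ : Fin r → Ω → ℝ)
    (κ : Kernel Ω (Configuration Λ)) : Prop :=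
  ∀ᵐ ω ∂ν, IsPfaffianField (κ ω) μ (diagKernel (fun k => ξ k ω) u)

end Pfaffian

end

/-! The correlation functions of a mixture are the averages over `ξ` of the determinants of `K_ξ`.
The theorem therefore rests on two facts. The first is the algebraic identity that the determinant
of `K` is the expectation of the determinant of `K_ξ`. The second is the existence of a Pfaffian
field for every projection kernel `K_I`.

The identity follows from `affineRankOne`: for self-dual `X`, the scalar determinant `detC (X + t v
v^*)` is affine in `t`. The determinant of `∑ c_k v_k v_k^*` is then affine in each `c_k`, so it is
interpolated from the vertices `c ∈ {0,1}^r` with exactly the Bernoulli weights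
(`detC_sum_smul_outer`).

Affinity is proved by induction on the size, through expansion in the smallest index (`detM_succ`).
Removing that index from a permutation changes neither the leaders nor the order of the other
cycles, so the expansion survives noncommutativity. It involves the derivative of the smaller
determinant in the direction `v v^*`, where `v` is the first column. By the induction hypothesis
this derivative is a difference of two determinants (`detC_succ_of_affine`). Adding `t W W^*` to the
matrix also changes that column, and `detC_add_outer_add` computes the effect. The two resulting `t
^ 2` terms cancel because `q^* q` is a scalar. Applying the expansion twice gives a formula
symmetric in the two smallest indices, hence invariance under relabelling (`detC_submatrix_perm`).

For `K_I`, orthonormality and Euler's identity give `∫ R_{m+1}(y, x) dμ(y) = (#I - m) R_m(x)`.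
Together with symmetry and positivity, this makes `R_{#I} / (#I)!` a probability density of `#I`
points whose correlation functions are the `R_m`.

An arbitrary mixture needs no more: the determinants of `K_ξ` fix its conditional factorial moments.
-/

namespace Pfaffian

/-! ### The cycle list of a permutation -/

/-- The orbit of `a` under `σ`, starting at `a`. -/
noncomputable def orbitList {n : ℕ} (σ : Equiv.Perm (Fin n)) (a : Fin n) : List (Fin n) :=
  (List.range (Function.minimalPeriod σ a)).map fun t => (σ ^ t) a

/-- The list `l` is the path `b, σ b, σ² b, …` up to the first return to `a` (excluded). -/
inductive ReturnPath {α : Type*} (σ : Equiv.Perm α) (a : α) : α → List α → Prop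
  | last (b : α) : σ b = a → ReturnPath σ a b [b]
  | step (b : α) (l : List α) : σ b ≠ a → ReturnPath σ a (σ b) l → ReturnPath σ a b (b :: l)

/-- Uniqueness identifies a cycle of `σ` with a modified cycle of `e` without comparing minimal
periods. -/
theorem ReturnPath.unique {α : Type*} {σ : Equiv.Perm α} {a b : α} {l l' : List α}
    (h : ReturnPath σ a b l) (h' : ReturnPath σ a b l') : l = l' := by
  induction h generalizing l' with
  | last b hb =>
    cases h' with
    | last _ _ => rfl
    | step _ _ hb' _ => exact absurd hb hb'
  | step b l hb _ ih =>
    cases h' with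
    | last _ hb' => exact absurd hb' hb
    | step _ _ _ h2 => rw [ih h2]

theorem minimalPeriod_perm_pos {n : ℕ} (σ : Equiv.Perm (Fin n)) (a : Fin n) :
    0 < Function.minimalPeriod σ a := by
  apply Function.minimalPeriod_pos_of_mem_periodicPts
  refine ⟨orderOf σ, orderOf_pos σ, ?_⟩
  rw [Function.IsPeriodicPt, Function.IsFixedPt, ← Equiv.Perm.coe_pow, pow_orderOf_eq_one]
  rfl

theorem returnPath_orbitList {n : ℕ} (σ : Equiv.Perm (Fin n)) (a : Fin n) :
    ReturnPath σ a a (orbitList σ a) := by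
  -- Induction on the number `d` of steps still to be made after `(σ ^ k) a` before the last vertex
  -- of the cycle.
  have key : ∀ d k : ℕ, k + (d + 1) = Function.minimalPeriod σ a →
      ReturnPath σ a ((σ ^ k) a) ((List.range' k (d + 1)).map fun t => (σ ^ t) a) := by
    intro d
    induction d with
    | zero =>
      intro k hk
      refine ReturnPath.last _ ?_
      rw [← Equiv.Perm.mul_apply, ← pow_succ', Equiv.Perm.coe_pow]
      simp only [hk]
      exact Function.iterate_minimalPeriod (f := σ) (x := a)
    | succ d ih =>
      intro k hk
      rw [List.range'_succ, List.map_cons]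
      have h1 : σ ((σ ^ k) a) = (σ ^ (k + 1)) a := by
        rw [← Equiv.Perm.mul_apply, ← pow_succ']
      refine ReturnPath.step _ _ ?_ ?_
      · rw [h1]
        intro h
        refine Function.not_isPeriodicPt_of_pos_of_lt_minimalPeriod (f := σ) (x := a)
          (n := k + 1) (by omega) (by omega) ?_
        rw [Function.IsPeriodicPt, Function.IsFixedPt, ← Equiv.Perm.coe_pow]
        exact h
      · rw [h1]
        exact ih (k + 1) (by omega)
  have hpos := minimalPeriod_perm_pos σ a
  have := key (Function.minimalPeriod σ a - 1) 0 (by omega)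
  rw [Nat.sub_add_cancel hpos] at this
  simpa [orbitList, List.range_eq_range'] using this

theorem mem_orbitList {n : ℕ} {σ : Equiv.Perm (Fin n)} {a b : Fin n} :
    b ∈ orbitList σ a ↔ σ.SameCycle a b := by
  simp only [orbitList, List.mem_map, List.mem_range]
  constructor
  · rintro ⟨t, -, rfl⟩
    exact ⟨t, by simp⟩
  · intro h
    obtain ⟨k, hk⟩ := h.exists_nat_pow_eq
    refine ⟨k % Function.minimalPeriod σ a, Nat.mod_lt _ (minimalPeriod_perm_pos σ a), ?_⟩
    rw [← hk, Equiv.Perm.coe_pow, Equiv.Perm.coe_pow, Function.iterate_mod_minimalPeriod_eq]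

/-- All indices in the order in which they occur in the Moore-Dyson term of `σ`. -/
noncomputable def cycleList {n : ℕ} (σ : Equiv.Perm (Fin n)) : List (Fin n) :=
  (cycleLeaders σ).flatMap (orbitList σ)

theorem prod_map_flatMap {α β M : Type*} [Monoid M] (l : List α) (f : α → List β) (g : β → M) :
    ((l.flatMap f).map g).prod = (l.map fun a => ((f a).map g).prod).prod := by
  induction l with
  | nil => simp
  | cons a l ih => simp [List.flatMap_cons, ih]

theorem detM_eq_sum_cycleList {R : Type*} [Ring R] {n : ℕ} (X : Matrix (Fin n) (Fin n) R) :
    detM X = ∑ σ : Equiv.Perm (Fin n), ((Equiv.Perm.sign σ : ℤˣ) : ℤ) •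
      ((cycleList σ).map fun i => X i (σ i)).prod := by
  refine Finset.sum_congr rfl fun σ _ => ?_
  rw [cycleList, prod_map_flatMap]
  congr 3
  funext a
  simp only [cycleProd, orbitList, List.map_map, Function.comp_def, pow_succ',
    Equiv.Perm.mul_apply]

/-! ### Removing the smallest index -/

/-- `σ` arises from `e` by inserting the index `0` into a cycle of `e` or as a fixed point. -/
def IsInsertion {n : ℕ} (σ : Equiv.Perm (Fin (n + 1))) (e : Equiv.Perm (Fin n)) : Prop :=
  ∀ i, σ i.succ = (e i).succ ∨ (σ i.succ = 0 ∧ σ 0 = (e i).succ)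

/-- The part of a path under `σ` that replaces the vertex `i` of a path under `e`. -/
def insertVertex {n : ℕ} (σ : Equiv.Perm (Fin (n + 1))) (i : Fin n) : List (Fin (n + 1)) :=
  if σ i.succ = 0 then [i.succ, 0] else [i.succ]

theorem ReturnPath.insertion {n : ℕ} {σ : Equiv.Perm (Fin (n + 1))} {e : Equiv.Perm (Fin n)}
    (h : IsInsertion σ e) {a b : Fin n} {l : List (Fin n)} (hl : ReturnPath e a b l) :
    ReturnPath σ a.succ b.succ (l.flatMap (insertVertex σ)) := by
  induction hl with
  | last b hb =>
    rcases h b with h1 | ⟨h1, h2⟩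
    · have h3 : σ b.succ ≠ 0 := by rw [h1]; exact Fin.succ_ne_zero _
      simp only [List.flatMap_cons, List.flatMap_nil, insertVertex, h3, if_false, List.append_nil]
      exact ReturnPath.last _ (by rw [h1, hb])
    · simp only [List.flatMap_cons, List.flatMap_nil, insertVertex, h1, if_true, List.append_nil]
      refine ReturnPath.step _ _ (by rw [h1]; exact (Fin.succ_ne_zero _).symm) ?_
      rw [h1]
      exact ReturnPath.last _ (by rw [h2, hb])
  | step b l hb _ ih =>
    have hb' : (e b).succ ≠ a.succ := fun h => hb (Fin.succ_injective _ h)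
    rcases h b with h1 | ⟨h1, h2⟩
    · have h3 : σ b.succ ≠ 0 := by rw [h1]; exact Fin.succ_ne_zero _
      simp only [List.flatMap_cons, insertVertex, h3, if_false, List.singleton_append]
      refine ReturnPath.step _ _ (by rw [h1]; exact hb') ?_
      rw [h1]
      exact ih
    · simp only [List.flatMap_cons, insertVertex, h1, if_true, List.cons_append, List.nil_append]
      refine ReturnPath.step _ _ (by rw [h1]; exact (Fin.succ_ne_zero _).symm) ?_
      rw [h1]
      refine ReturnPath.step _ _ (by rw [h2]; exact hb') ?_
      rw [h2]
      exact ih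

theorem orbitList_succ {n : ℕ} {σ : Equiv.Perm (Fin (n + 1))} {e : Equiv.Perm (Fin n)}
    (h : IsInsertion σ e) (a : Fin n) :
    orbitList σ a.succ = (orbitList e a).flatMap (insertVertex σ) :=
  (returnPath_orbitList σ a.succ).unique ((returnPath_orbitList e a).insertion h)

theorem succ_mem_flatMap_insertVertex {n : ℕ} {σ : Equiv.Perm (Fin (n + 1))} {l : List (Fin n)}
    {b : Fin n} : b.succ ∈ l.flatMap (insertVertex σ) ↔ b ∈ l := by
  simp only [List.mem_flatMap, insertVertex]
  constructor
  · rintro ⟨c, hc, h⟩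
    split_ifs at h <;> simp at h <;> simpa [h] using hc
  · intro hb
    refine ⟨b, hb, ?_⟩
    split_ifs <;> simp

theorem sameCycle_succ {n : ℕ} {σ : Equiv.Perm (Fin (n + 1))} {e : Equiv.Perm (Fin n)}
    (h : IsInsertion σ e) (a b : Fin n) : σ.SameCycle a.succ b.succ ↔ e.SameCycle a b := by
  rw [← mem_orbitList, ← mem_orbitList, orbitList_succ h, succ_mem_flatMap_insertVertex]

/-- Being the smallest index, `0` leads a cycle only as a fixed point, and then it comes last in the
decreasing order. All other leaders stay as they were. -/
theorem cycleLeaders_insertion {n : ℕ} {σ : Equiv.Perm (Fin (n + 1))} {e : Equiv.Perm (Fin n)}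
    (h : IsInsertion σ e) :
    cycleLeaders σ = (cycleLeaders e).map Fin.succ ++ (if σ 0 = 0 then [0] else []) := by
  classical
  unfold cycleLeaders
  rw [List.finRange_succ, List.reverse_cons, List.filter_append, ← List.map_reverse,
    List.filter_map]
  congr 1
  · congr 1
    refine List.filter_congr fun a _ => ?_
    simp only [Function.comp, decide_eq_decide]
    constructor
    · intro hh b hb
      exact Fin.succ_le_succ_iff.1 (hh b.succ ((sameCycle_succ h a b).2 hb))
    · intro hh b hb
      rcases Fin.eq_zero_or_eq_succ b with rfl | ⟨b, rfl⟩
      · exact Fin.zero_le _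
      · exact Fin.succ_le_succ_iff.2 (hh b ((sameCycle_succ h a b).1 hb))
  · by_cases h0 : σ 0 = 0
    · rw [if_pos h0, List.filter_singleton]
      rw [decide_eq_true, cond_true]
      rintro b hb
      rw [← mem_orbitList, ← (ReturnPath.last (σ := σ) 0 h0).unique (returnPath_orbitList σ 0)] at hb
      simp at hb
      simp [hb]
    · rw [if_neg h0, List.filter_singleton, decide_eq_false, cond_false]
      intro hh
      have := hh (σ 0) ⟨1, by simp⟩
      exact h0 (le_antisymm this (Fin.zero_le _))

theorem cycleList_insertion {n : ℕ} {σ : Equiv.Perm (Fin (n + 1))} {e : Equiv.Perm (Fin n)}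
    (h : IsInsertion σ e) :
    cycleList σ = (cycleList e).flatMap (insertVertex σ) ++ (if σ 0 = 0 then [0] else []) := by
  unfold cycleList
  rw [cycleLeaders_insertion h, List.flatMap_append, List.flatMap_map, List.flatMap_assoc]
  simp only [orbitList_succ h]
  congr 1
  split_ifs with h0
  · simp [← (ReturnPath.last (σ := σ) 0 h0).unique (returnPath_orbitList σ 0)]
  · simp

/-- Here `p` is the image of `0`: for `p = 0` it is a fixed point, and for `p = (e i).succ` it sits
between `i.succ` and `(e i).succ`. -/
theorem isInsertion_decomposeFin {n : ℕ} (p : Fin (n + 1)) (e : Equiv.Perm (Fin n)) :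
    IsInsertion (Equiv.Perm.decomposeFin.symm (p, e)) e := by
  intro i
  rw [Equiv.Perm.decomposeFin_symm_apply_succ, Equiv.Perm.decomposeFin_symm_apply_zero]
  by_cases hp : (e i).succ = p
  · right
    rw [← hp]
    simp
  · left
    exact Equiv.swap_apply_of_ne_of_ne (Fin.succ_ne_zero _) hp

theorem decomposeFin_symm_succ_eq_zero {n : ℕ} (p : Fin (n + 1)) (e : Equiv.Perm (Fin n))
    (i : Fin n) : Equiv.Perm.decomposeFin.symm (p, e) i.succ = 0 ↔ (e i).succ = p := by
  rw [Equiv.Perm.decomposeFin_symm_apply_succ]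
  rw [← Equiv.apply_eq_iff_eq (Equiv.swap 0 p), Equiv.swap_apply_self, Equiv.swap_apply_left]

/-- By induction every index is counted once. A successor comes from its own vertex; `0` comes
either from the end of the list or from the unique vertex that `σ` sends to it. -/
theorem cycleList_perm {n : ℕ} (σ : Equiv.Perm (Fin n)) :
    (cycleList σ).Perm (List.finRange n) := by
  induction n with
  | zero =>
    have : cycleList σ = [] := by
      cases hc : cycleList σ with
      | nil => rfl
      | cons a _ => exact a.elim0
    simp [this]
  | succ n ih =>
    obtain ⟨⟨p, e⟩, rfl⟩ := Equiv.Perm.decomposeFin.symm.surjective σ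
    have hins := isInsertion_decomposeFin p e
    rw [cycleList_insertion hins]
    have h1 := (ih e).flatMap_right (insertVertex (Equiv.Perm.decomposeFin.symm (p, e)))
    refine (h1.append_right _).trans ?_
    rw [List.perm_iff_count]
    intro b
    rw [List.count_eq_one_of_mem (List.nodup_finRange _) (List.mem_finRange _), List.count_append,
      List.count_flatMap, ← List.ofFn_eq_map, List.sum_ofFn]
    rw [Equiv.Perm.decomposeFin_symm_apply_zero]
    rcases Fin.eq_zero_or_eq_succ b with rfl | ⟨b, rfl⟩
    · have h2 : ∀ i : Fin n, List.count (0 : Fin (n + 1)) (insertVertex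
          (Equiv.Perm.decomposeFin.symm (p, e)) i) = if (e i).succ = p then 1 else 0 := by
        intro i
        rw [insertVertex]
        simp only [decomposeFin_symm_succ_eq_zero]
        split_ifs <;> simp
      simp only [Function.comp, h2]
      rcases Fin.eq_zero_or_eq_succ p with rfl | ⟨j, rfl⟩
      · simp
      · simp only [Fin.succ_inj, Fin.succ_ne_zero, if_false, List.count_nil, add_zero]
        rw [Equiv.sum_comp e (fun i => if i = j then 1 else 0)]
        simp
    · have h2 : ∀ i : Fin n, List.count b.succ (insertVertex
          (Equiv.Perm.decomposeFin.symm (p, e)) i) = if i = b then 1 else 0 := by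
        intro i
        rw [insertVertex]
        split_ifs <;> simp_all [Fin.succ_ne_zero, (Fin.succ_ne_zero _).symm]
      simp only [Function.comp, h2]
      simp only [Finset.sum_ite_eq', Finset.mem_univ, if_true]
      split_ifs <;> simp [(Fin.succ_ne_zero _).symm]

theorem nodup_cycleList {n : ℕ} (σ : Equiv.Perm (Fin n)) : (cycleList σ).Nodup :=
  (cycleList_perm σ).nodup_iff.2 (List.nodup_finRange n)

theorem detM_zero_dim {R : Type*} [Ring R] (X : Matrix (Fin 0) (Fin 0) R) : detM X = 1 := by
  rw [detM_eq_sum_cycleList]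
  have : ∀ σ : Equiv.Perm (Fin 0), cycleList σ = [] := fun σ => by
    simpa using cycleList_perm σ
  simp [this]

/-- The derivative of `detM` at `X` in the direction `Y`. -/
noncomputable def detMDeriv {R : Type*} [Ring R] {n : ℕ} (X Y : Matrix (Fin n) (Fin n) R) : R :=
  ∑ σ : Equiv.Perm (Fin n), ((Equiv.Perm.sign σ : ℤˣ) : ℤ) •
    ∑ i, ((cycleList σ).map (Function.update (fun k => X k (σ k)) i (Y i (σ i)))).prod

/-- Expansion of the Moore-Dyson determinant with respect to the smallest index. -/
theorem detM_succ {R : Type*} [Ring R] {n : ℕ} (X : Matrix (Fin (n + 1)) (Fin (n + 1)) R) :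
    detM X = detM (X.submatrix Fin.succ Fin.succ) * X 0 0 -
      detMDeriv (X.submatrix Fin.succ Fin.succ)
        (Matrix.of fun i j => X i.succ 0 * X 0 j.succ) := by
  rw [detM_eq_sum_cycleList, ← Equiv.sum_comp Equiv.Perm.decomposeFin.symm,
    Fintype.sum_prod_type, Fin.sum_univ_succ, sub_eq_add_neg]
  congr 1
  -- Permutations fixing `0`: the sign is unchanged and the factor `X 0 0` stands last.
  · rw [detM_eq_sum_cycleList, Finset.sum_mul]
    refine Finset.sum_congr rfl fun e _ => ?_
    rw [Equiv.Perm.decomposeFin.symm_sign, if_pos rfl, one_mul, smul_mul_assoc]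
    congr 1
    rw [cycleList_insertion (isInsertion_decomposeFin 0 e)]
    have h0 : Equiv.Perm.decomposeFin.symm ((0 : Fin (n + 1)), e) 0 = 0 := by simp
    rw [if_pos h0, List.map_append, List.prod_append, prod_map_flatMap]
    congr 1
    · congr 2
      funext i
      simp [insertVertex]
    · simp
  -- Inserting `0` between `i` and `e i` flips the sign and replaces one factor by `X i.succ 0 * X 0
  -- (e i).succ`, at the same place of the product. Summing over `i` is the product rule.
  · rw [Finset.sum_comm, detMDeriv, ← Finset.sum_neg_distrib]
    refine Finset.sum_congr rfl fun e _ => ?_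
    rw [Finset.smul_sum, ← Finset.sum_neg_distrib, ← Equiv.sum_comp e]
    refine Finset.sum_congr rfl fun i _ => ?_
    rw [Equiv.Perm.decomposeFin.symm_sign, if_neg (Fin.succ_ne_zero _)]
    simp only [neg_mul, one_mul, Units.val_neg, neg_smul]
    congr 2
    rw [cycleList_insertion (isInsertion_decomposeFin _ e)]
    rw [if_neg (by simp [Fin.succ_ne_zero]), List.append_nil, prod_map_flatMap]
    congr 2
    funext k
    by_cases hk : k = i
    · subst hk
      simp [insertVertex]
    · have hk' : e k ≠ e i := fun h => hk (e.injective h)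
      have h0 : Equiv.Perm.decomposeFin.symm ((e i).succ, e) k.succ ≠ 0 := by
        rw [Ne, decomposeFin_symm_succ_eq_zero, Fin.succ_inj]
        exact hk'
      rw [Function.update_of_ne hk, insertVertex, if_neg h0]
      have h1 := (isInsertion_decomposeFin (e i).succ e k).resolve_right (fun h => h0 h.1)
      simp only [List.map_cons, List.map_nil, List.prod_singleton, h1, Matrix.submatrix_apply]

/-- Euler's identity: each term is a product of `n` entries. -/
theorem detMDeriv_self {R : Type*} [Ring R] {n : ℕ} (X : Matrix (Fin n) (Fin n) R) :
    detMDeriv X X = n • detM X := by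
  rw [detM_eq_sum_cycleList, detMDeriv, Finset.smul_sum]
  refine Finset.sum_congr rfl fun σ _ => ?_
  rw [smul_comm]
  simp

/-- A product over a list without duplicates is linear in each factor. -/
theorem exists_prod_map_update {R ι : Type*} [Ring R] [DecidableEq ι] (l : List ι)
    (hl : l.Nodup) (w : ι → R) (i : ι) (hi : i ∈ l) :
    ∃ a b : R, ∀ y, (l.map (Function.update w i y)).prod = a * y * b := by
  induction l with
  | nil => simp at hi
  | cons k l ih =>
    rw [List.nodup_cons] at hl
    by_cases hk : k = i
    · subst hk
      refine ⟨1, (l.map w).prod, fun y => ?_⟩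
      rw [List.map_cons, List.prod_cons, Function.update_self, one_mul]
      congr 2
      refine List.map_congr_left fun j hj => Function.update_of_ne ?_ _ _
      rintro rfl
      exact hl.1 hj
    · obtain ⟨a, b, hab⟩ := ih hl.2 (by simpa [Ne.symm hk] using hi)
      refine ⟨w k * a, b, fun y => ?_⟩
      rw [List.map_cons, List.prod_cons, Function.update_of_ne hk, hab]
      simp only [mul_assoc]

theorem detMDeriv_add {R : Type*} [Ring R] {n : ℕ} (X Y Z : Matrix (Fin n) (Fin n) R) :
    detMDeriv X (Y + Z) = detMDeriv X Y + detMDeriv X Z := by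
  unfold detMDeriv
  simp only [← Finset.sum_add_distrib, ← smul_add]
  refine Finset.sum_congr rfl fun σ _ => ?_
  congr 1
  refine Finset.sum_congr rfl fun i _ => ?_
  obtain ⟨a, b, h⟩ := exists_prod_map_update (cycleList σ) (nodup_cycleList σ)
    (fun k => X k (σ k)) i ((cycleList_perm σ).mem_iff.2 (List.mem_finRange i))
  simp only [h, Matrix.add_apply, mul_add, add_mul]

theorem detMDeriv_smul {A R : Type*} [CommRing A] [Ring R] [Algebra A R] {n : ℕ} (c : A)
    (X Y : Matrix (Fin n) (Fin n) R) :
    detMDeriv X (c • Y) = c • detMDeriv X Y := by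
  unfold detMDeriv
  simp only [Finset.smul_sum]
  refine Finset.sum_congr rfl fun σ _ => Finset.sum_congr rfl fun i _ => ?_
  obtain ⟨a, b, h⟩ := exists_prod_map_update (cycleList σ) (nodup_cycleList σ)
    (fun k => X k (σ k)) i ((cycleList_perm σ).mem_iff.2 (List.mem_finRange i))
  rw [smul_comm c]
  simp only [h, Matrix.smul_apply, mul_smul_comm, smul_mul_assoc]

set_option maxSynthPendingDepth 3

/-! ### Componentwise derivatives -/

/-- The derivative of a quaternion valued function of a complex variable, by components. -/
structure HasQDerivAt (F : ℂ → ℍ[ℂ]) (F' : ℍ[ℂ]) (x : ℂ) : Prop where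
  re : HasDerivAt (fun t => (F t).re) F'.re x
  imI : HasDerivAt (fun t => (F t).imI) F'.imI x
  imJ : HasDerivAt (fun t => (F t).imJ) F'.imJ x
  imK : HasDerivAt (fun t => (F t).imK) F'.imK x

theorem HasQDerivAt.const (q : ℍ[ℂ]) (x : ℂ) : HasQDerivAt (fun _ => q) 0 x :=
  ⟨hasDerivAt_const _ _, hasDerivAt_const _ _, hasDerivAt_const _ _, hasDerivAt_const _ _⟩

theorem HasQDerivAt.add {F G : ℂ → ℍ[ℂ]} {F' G' : ℍ[ℂ]} {x : ℂ} (hF : HasQDerivAt F F' x)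
    (hG : HasQDerivAt G G' x) : HasQDerivAt (fun t => F t + G t) (F' + G') x :=
  ⟨hF.re.add hG.re, hF.imI.add hG.imI, hF.imJ.add hG.imJ, hF.imK.add hG.imK⟩

theorem HasQDerivAt.sum {ι : Type*} {s : Finset ι} {F : ι → ℂ → ℍ[ℂ]} {F' : ι → ℍ[ℂ]} {x : ℂ}
    (h : ∀ i ∈ s, HasQDerivAt (F i) (F' i) x) :
    HasQDerivAt (fun t => ∑ i ∈ s, F i t) (∑ i ∈ s, F' i) x := by
  classical
  induction s using Finset.induction_on with
  | empty => simpa using HasQDerivAt.const 0 x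
  | insert i s hi ih =>
    simp only [Finset.sum_insert hi]
    exact (h i (Finset.mem_insert_self _ _)).add
      (ih fun j hj => h j (Finset.mem_insert_of_mem hj))

theorem HasQDerivAt.mul {F G : ℂ → ℍ[ℂ]} {F' G' : ℍ[ℂ]} {x : ℂ} (hF : HasQDerivAt F F' x)
    (hG : HasQDerivAt G G' x) :
    HasQDerivAt (fun t => F t * G t) (F' * G x + F x * G') x := by
  obtain ⟨f0, f1, f2, f3⟩ := hF
  obtain ⟨g0, g1, g2, g3⟩ := hG
  constructor
  · simp only [Quaternion.re_mul, Quaternion.re_add]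
    exact ((((f0.mul g0).sub (f1.mul g1)).sub (f2.mul g2)).sub (f3.mul g3)).congr_deriv (by ring)
  · simp only [Quaternion.imI_mul, Quaternion.imI_add]
    exact ((((f0.mul g1).add (f1.mul g0)).add (f2.mul g3)).sub (f3.mul g2)).congr_deriv (by ring)
  · simp only [Quaternion.imJ_mul, Quaternion.imJ_add]
    exact ((((f0.mul g2).sub (f1.mul g3)).add (f2.mul g0)).add (f3.mul g1)).congr_deriv (by ring)
  · simp only [Quaternion.imK_mul, Quaternion.imK_add]
    exact ((((f0.mul g3).add (f1.mul g2)).sub (f2.mul g1)).add (f3.mul g0)).congr_deriv (by ring)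

theorem HasQDerivAt.zsmul {F : ℂ → ℍ[ℂ]} {F' : ℍ[ℂ]} {x : ℂ} (n : ℤ) (hF : HasQDerivAt F F' x) :
    HasQDerivAt (fun t => n • F t) (n • F') x := by
  have := (HasQDerivAt.const ((n : ℤ) : ℍ[ℂ]) x).mul hF
  simpa [zsmul_eq_mul] using this

theorem HasQDerivAt.add_smul (p q : ℍ[ℂ]) (x : ℂ) : HasQDerivAt (fun t => p + t • q) q x := by
  have key : ∀ a b : ℂ, HasDerivAt (fun t : ℂ => a + t * b) b x := fun a b => by
    simpa using ((hasDerivAt_id x).mul_const b).const_add a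
  constructor <;>
    simp only [Quaternion.re_add, Quaternion.imI_add, Quaternion.imJ_add, Quaternion.imK_add,
      Quaternion.re_smul, Quaternion.imI_smul, Quaternion.imJ_smul, Quaternion.imK_smul,
      smul_eq_mul] <;> exact key _ _

theorem hasQDerivAt_list_prod {ι : Type*} [DecidableEq ι] (l : List ι) (hl : l.Nodup)
    (w y : ι → ℍ[ℂ]) :
    HasQDerivAt (fun t => (l.map fun i => w i + t • y i).prod)
      (∑ i ∈ l.toFinset, (l.map (Function.update w i (y i))).prod) 0 := by
  induction l with
  | nil => simpa using HasQDerivAt.const 1 0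
  | cons k l ih =>
    rw [List.nodup_cons] at hl
    have h := (HasQDerivAt.add_smul (w k) (y k) 0).mul (ih hl.2)
    simp only [zero_smul, add_zero] at h
    simp only [List.map_cons, List.prod_cons, List.toFinset_cons]
    rw [Finset.sum_insert (by simpa using hl.1)]
    convert h using 2
    · rw [Function.update_self]
      congr 2
      refine List.map_congr_left fun j hj => Function.update_of_ne ?_ _ _
      rintro rfl
      exact hl.1 hj
    · rw [Finset.mul_sum]
      refine Finset.sum_congr rfl fun i hi => ?_
      rw [Function.update_of_ne]
      rintro rfl
      exact hl.1 (by simpa using hi)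

/-- This lets facts about the determinants along a line `X + t • Y` pass to `detMDeriv X Y`. -/
theorem hasQDerivAt_detM {n : ℕ} (X Y : Matrix (Fin n) (Fin n) ℍ[ℂ]) :
    HasQDerivAt (fun t => detM (X + t • Y)) (detMDeriv X Y) 0 := by
  simp only [detM_eq_sum_cycleList, detMDeriv]
  refine HasQDerivAt.sum fun σ _ => HasQDerivAt.zsmul _ ?_
  have h := hasQDerivAt_list_prod (cycleList σ) (nodup_cycleList σ) (fun k => X k (σ k))
    (fun k => Y k (σ k))
  have h2 : (cycleList σ).toFinset = Finset.univ := by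
    ext i
    simp [(cycleList_perm σ).mem_iff]
  rw [h2] at h
  exact h

/-! ### Self-dual matrices -/

/-- `X` equals its conjugate transpose (for the quaternion conjugation). -/
def IsSelfDual {n : ℕ} (X : Matrix (Fin n) (Fin n) ℍ[ℂ]) : Prop :=
  ∀ i j, X j i = star (X i j)

/-- The matrix `v w^*`. -/
def outer {n : ℕ} (v w : Fin n → ℍ[ℂ]) : Matrix (Fin n) (Fin n) ℍ[ℂ] :=
  Matrix.of fun i j => v i * star (w j)

theorem star_smul_complex (t : ℂ) (q : ℍ[ℂ]) : star (t • q) = t • star q := by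
  ext <;> simp

theorem IsSelfDual.add {n : ℕ} {X Y : Matrix (Fin n) (Fin n) ℍ[ℂ]} (hX : IsSelfDual X)
    (hY : IsSelfDual Y) : IsSelfDual (X + Y) := fun i j => by
  simp [hX i j, hY i j]

theorem IsSelfDual.smul {n : ℕ} {X : Matrix (Fin n) (Fin n) ℍ[ℂ]} (hX : IsSelfDual X) (t : ℂ) :
    IsSelfDual (t • X) := fun i j => by
  rw [Matrix.smul_apply, Matrix.smul_apply, hX i j, star_smul_complex]

theorem isSelfDual_outer {n : ℕ} (v : Fin n → ℍ[ℂ]) : IsSelfDual (outer v v) := fun i j => by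
  simp [outer]

theorem isSelfDual_outer_add {n : ℕ} (v w : Fin n → ℍ[ℂ]) :
    IsSelfDual (outer v w + outer w v) := fun i j => by
  simp [outer, add_comm]

theorem IsSelfDual.submatrix {n m : ℕ} {X : Matrix (Fin n) (Fin n) ℍ[ℂ]} (hX : IsSelfDual X)
    (f : Fin m → Fin n) : IsSelfDual (X.submatrix f f) := fun i j => hX (f i) (f j)

theorem eq_coe_re_of_star_eq {q : ℍ[ℂ]} (h : q = star q) : q = ((q.re : ℂ) : ℍ[ℂ]) := by
  have key : ∀ z : ℂ, z = -z → z = 0 := fun z hz => by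
    linear_combination (1 / 2 : ℂ) * hz
  have h1 := congrArg (fun q => QuaternionAlgebra.imI q) h
  have h2 := congrArg (fun q => QuaternionAlgebra.imJ q) h
  have h3 := congrArg (fun q => QuaternionAlgebra.imK q) h
  simp only [Quaternion.imI_star, Quaternion.imJ_star, Quaternion.imK_star] at h1 h2 h3
  ext <;> simp [key _ h1, key _ h2, key _ h3]

/-- Self-duality makes the direction in the expansion a square `v v^*`, which is itself self-dual.
-/
theorem outer_firstColumn {n : ℕ} {X : Matrix (Fin (n + 1)) (Fin (n + 1)) ℍ[ℂ]}
    (hX : IsSelfDual X) :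
    (Matrix.of fun i j : Fin n => X i.succ 0 * X 0 j.succ) =
      outer (fun i => X i.succ 0) (fun i => X i.succ 0) := by
  ext1 i j
  simp [outer, hX j.succ 0]

/-- The Moore-Dyson determinant of a self-dual matrix is a scalar. -/
theorem detM_eq_coe_re {n : ℕ} {X : Matrix (Fin n) (Fin n) ℍ[ℂ]} (hX : IsSelfDual X) :
    detM X = (((detM X).re : ℂ) : ℍ[ℂ]) := by
  induction n with
  | zero =>
    rw [detM_zero_dim]
    simp
  | succ n ih =>
    set X' := X.submatrix Fin.succ Fin.succ with hX'
    set Y := outer (fun i : Fin n => X i.succ 0) (fun i => X i.succ 0) with hY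
    have hd := hasQDerivAt_detM X' Y
    -- The line stays self-dual, so by induction the imaginary components vanish along it, and so do
    -- their derivatives.
    have hsd : ∀ t : ℂ, IsSelfDual (X' + t • Y) := fun t =>
      (hX.submatrix _).add ((isSelfDual_outer _).smul t)
    have hI : (detMDeriv X' Y).imI = 0 := by
      refine hd.imI.unique ((hasDerivAt_const (0 : ℂ) (0 : ℂ)).congr_of_eventuallyEq
        (Filter.Eventually.of_forall fun t => ?_))
      simp only
      rw [ih (hsd t), Quaternion.imI_coe]
    have hJ : (detMDeriv X' Y).imJ = 0 := by
      refine hd.imJ.unique ((hasDerivAt_const (0 : ℂ) (0 : ℂ)).congr_of_eventuallyEq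
        (Filter.Eventually.of_forall fun t => ?_))
      simp only
      rw [ih (hsd t), Quaternion.imJ_coe]
    have hK : (detMDeriv X' Y).imK = 0 := by
      refine hd.imK.unique ((hasDerivAt_const (0 : ℂ) (0 : ℂ)).congr_of_eventuallyEq
        (Filter.Eventually.of_forall fun t => ?_))
      simp only
      rw [ih (hsd t), Quaternion.imK_coe]
    rw [detM_succ, outer_firstColumn hX, ← hX', ← hY, ih (hX.submatrix _),
      eq_coe_re_of_star_eq (hX 0 0)]
    ext <;> simp [hI, hJ, hK]

/-- The Moore-Dyson determinant of a self-dual matrix as a complex number. -/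
noncomputable def detC {n : ℕ} (X : Matrix (Fin n) (Fin n) ℍ[ℂ]) : ℂ := (detM X).re

theorem detC_succ {n : ℕ} {X : Matrix (Fin (n + 1)) (Fin (n + 1)) ℍ[ℂ]} (hX : IsSelfDual X) :
    detC X = detC (X.submatrix Fin.succ Fin.succ) * (X 0 0).re -
      (detMDeriv (X.submatrix Fin.succ Fin.succ)
        (outer (fun i => X i.succ 0) fun i => X i.succ 0)).re := by
  rw [detC, detC, detM_succ, outer_firstColumn hX, detM_eq_coe_re (hX.submatrix Fin.succ),
    Quaternion.re_sub, Quaternion.re_coe, Quaternion.re_mul]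
  simp

/-! ### Rank one perturbations -/

/-- `detC` is affine along rank one perturbations of self-dual matrices of size `n`. -/
def AffineRankOne (n : ℕ) : Prop :=
  ∀ X : Matrix (Fin n) (Fin n) ℍ[ℂ], IsSelfDual X → ∀ (v : Fin n → ℍ[ℂ]) (t : ℂ),
    detC (X + t • outer v v) = detC X + t * (detC (X + outer v v) - detC X)

/-- The slope of an affine function is its increment from `0` to `1`. -/
theorem re_detMDeriv_outer {n : ℕ} (h : AffineRankOne n) {X : Matrix (Fin n) (Fin n) ℍ[ℂ]}
    (hX : IsSelfDual X) (v : Fin n → ℍ[ℂ]) :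
    (detMDeriv X (outer v v)).re = detC (X + outer v v) - detC X := by
  refine (hasQDerivAt_detM X (outer v v)).re.unique ?_
  change HasDerivAt (fun t => detC (X + t • outer v v)) _ 0
  simp only [h X hX v]
  simpa using ((hasDerivAt_id (0 : ℂ)).mul_const (detC (X + outer v v) - detC X)).const_add (detC X)

/-- From here on cycles play no role: a determinant is expressed by determinants of self-dual
matrices one size smaller. -/
theorem detC_succ_of_affine {n : ℕ} (h : AffineRankOne n)
    {X : Matrix (Fin (n + 1)) (Fin (n + 1)) ℍ[ℂ]} (hX : IsSelfDual X) :
    detC X = ((X 0 0).re + 1) * detC (X.submatrix Fin.succ Fin.succ) -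
      detC (X.submatrix Fin.succ Fin.succ +
        outer (fun i => X i.succ 0) fun i => X i.succ 0) := by
  rw [detC_succ hX, re_detMDeriv_outer h (hX.submatrix _)]
  ring

/-- A function on binary quadratic forms that is affine along squares of linear forms is an
affine function plus a multiple of the discriminant. -/
theorem exists_discriminant_expansion (g : ℂ → ℂ → ℂ → ℂ)
    (h : ∀ p q α β γ t : ℂ, g (α + t * p ^ 2) (β + t * (p * q)) (γ + t * q ^ 2) =
      g α β γ + t * (g (α + p ^ 2) (β + p * q) (γ + q ^ 2) - g α β γ)) :
    ∃ P Q S E : ℂ, ∀ α β γ,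
      g α β γ = g 0 0 0 + α * P + γ * Q + β * S + (α * γ - β ^ 2) * E := by
  -- The forms `x²`, `y²` and `(x + y)²` span the binary quadratic forms, with coordinates `α - β`,
  -- `γ - β` and `β`. In these coordinates `g` is affine in each variable.
  have hα : ∀ α β γ, g α β γ = g 0 β γ + α * (g 1 β γ - g 0 β γ) := fun α β γ => by
    simpa using h 1 0 0 β γ α
  have hγ : ∀ α β γ, g α β γ = g α β 0 + γ * (g α β 1 - g α β 0) := fun α β γ => by
    simpa using h 0 1 α β 0 γ
  have hb : ∀ x y b, g (x + b) b (y + b) = g x 0 y + b * (g (x + 1) 1 (y + 1) - g x 0 y) :=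
    fun x y b => by simpa using h 1 1 x 0 y b
  have key : ∃ c0 c1 c2 c3 c12 c13 c23 c123 : ℂ, ∀ x y b, g (x + b) b (y + b) =
      c0 + c1 * x + c2 * y + c3 * b + c12 * (x * y) + c13 * (x * b) + c23 * (y * b) +
        c123 * (x * y * b) := by
    have h0 : ∀ b, ∃ d0 d1 d2 d12 : ℂ, ∀ x y, g x b y = d0 + d1 * x + d2 * y + d12 * (x * y) := by
      intro b
      refine ⟨g 0 b 0, g 1 b 0 - g 0 b 0, g 0 b 1 - g 0 b 0,
        g 1 b 1 - g 0 b 1 - g 1 b 0 + g 0 b 0, fun x y => ?_⟩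
      rw [hα x b y, hγ 0 b y, hγ 1 b y]
      ring
    obtain ⟨d0, d1, d2, d12, hd⟩ := h0 0
    obtain ⟨e0, e1, e2, e12, he⟩ := h0 1
    refine ⟨d0, d1, d2, e0 + e1 + e2 + e12 - d0, d12, e1 + e12 - d1, e2 + e12 - d2, e12 - d12,
      fun x y b => ?_⟩
    rw [hb, hd, he]
    ring
  obtain ⟨c0, c1, c2, c3, c12, c13, c23, c123, hc⟩ := key
  have hg : ∀ α β γ, g α β γ = c0 + c1 * (α - β) + c2 * (γ - β) + c3 * β +
      c12 * ((α - β) * (γ - β)) + c13 * ((α - β) * β) + c23 * ((γ - β) * β) +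
        c123 * ((α - β) * (γ - β) * β) := fun α β γ => by
    rw [← hc]
    simp
  -- The squares of `x - y` and `x + 2y` supply the missing relations: the cubic coefficient
  -- vanishes and the three quadratic ones agree. Their common factor, the second elementary
  -- symmetric polynomial of the coordinates, is `α γ - β ^ 2`.
  have r1 := h 1 (-1) 0 0 0 (-1)
  have r2 := h 1 (-1) 0 0 0 2
  have r3 := h 1 2 0 0 0 (-1)
  simp only [hg] at r1 r2 r3
  have e123 : c123 = 0 := by linear_combination (-1 / 24 : ℂ) * (r2 - r1)
  subst e123
  have e1 : 2 * c12 = c13 + c23 := by linear_combination (1 / 4 : ℂ) * r1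
  have e2 : c12 + c13 = 2 * c23 := by linear_combination (-1 / 4 : ℂ) * r3
  have e3 : c13 = c12 := by linear_combination (1 / 3 : ℂ) * (e2 - 2 * e1)
  have e4 : c23 = c12 := by linear_combination (-1 : ℂ) * e1 - e3
  refine ⟨c1, c2, c3 - c1 - c2, c12, fun α β γ => ?_⟩
  rw [hg α β γ, hg 0 0 0, e3, e4]
  ring

/-- The square of the linear form with coefficients `p, q` corresponds to the rank one matrix of `p
v + q w`. -/
theorem detC_discriminant_expansion {n : ℕ} (h : AffineRankOne n)
    {X : Matrix (Fin n) (Fin n) ℍ[ℂ]} (hX : IsSelfDual X) (v w : Fin n → ℍ[ℂ]) :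
    ∃ P Q S E : ℂ, ∀ α β γ : ℂ,
      detC (X + α • outer v v + β • (outer v w + outer w v) + γ • outer w w) =
        detC X + α * P + γ * Q + β * S + (α * γ - β ^ 2) * E := by
  have := exists_discriminant_expansion (fun α β γ : ℂ =>
    detC (X + α • outer v v + β • (outer v w + outer w v) + γ • outer w w)) ?_
  · simpa using this
  intro p q α β γ t
  have hsd : IsSelfDual (X + α • outer v v + β • (outer v w + outer w v) + γ • outer w w) :=
    ((hX.add ((isSelfDual_outer _).smul _)).add ((isSelfDual_outer_add _ _).smul _)).add
      ((isSelfDual_outer _).smul _)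
  have h1 : ∀ t : ℂ, X + (α + t * p ^ 2) • outer v v +
      (β + t * (p * q)) • (outer v w + outer w v) + (γ + t * q ^ 2) • outer w w =
      X + α • outer v v + β • (outer v w + outer w v) + γ • outer w w +
        t • outer (fun i => p • v i + q • w i) (fun i => p • v i + q • w i) := by
    intro t
    have h2 : outer (fun i => p • v i + q • w i) (fun i => p • v i + q • w i) =
        p ^ 2 • outer v v + (p * q) • (outer v w + outer w v) + q ^ 2 • outer w w := by
      ext1 i j
      simp only [outer, Matrix.of_apply, Matrix.add_apply, Matrix.smul_apply, star_add,
        star_smul_complex, mul_add, add_mul, smul_mul_assoc, mul_smul_comm, smul_smul, smul_add,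
        pow_two, mul_comm q p]
      abel
    rw [h2]
    module
  have h3 := h1 1
  simp only [one_mul] at h3
  simp only [h1, h3, one_smul]
  exact h _ hsd _ t

theorem star_mul_self_eq_coe (q : ℍ[ℂ]) : star q * q = (((q * star q).re : ℂ) : ℍ[ℂ]) := by
  ext <;> simp <;> ring

theorem coe_mul_eq_smul (z : ℂ) (q : ℍ[ℂ]) : (z : ℍ[ℂ]) * q = z • q :=
  Quaternion.coe_mul_eq_smul z q

/-- If `t W W^*` is added to a matrix with first column `v` below the corner, then that column
becomes `v + t w q^*`, where `q = W 0` and `w` is the rest of `W`. With `p = w q^*`, the matrix `p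
p^*` is the scalar `q q^*` times `w w^*`, which produces the `t ^ 2` term. -/
theorem detC_add_outer_add {n : ℕ} (h : AffineRankOne n) {X : Matrix (Fin n) (Fin n) ℍ[ℂ]}
    (hX : IsSelfDual X) (v w : Fin n → ℍ[ℂ]) (q : ℍ[ℂ]) (t : ℂ) :
    detC (X + t • outer w w +
        outer (fun i => v i + t • (w i * star q)) (fun i => v i + t • (w i * star q))) =
      detC (X + outer v v) + t * (detC (X + outer v v + outer w w) - detC (X + outer v v)) +
        t ^ 2 * (q * star q).re * (detC (X + outer w w) - detC X) +
        t * (1 / 2 * (detC (X + (outer (fun i => v i * q) w + outer w fun i => v i * q)) -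
          detC (X - (outer (fun i => v i * q) w + outer w fun i => v i * q)))) := by
  set N := (q * star q).re with hN
  set T := outer (fun i => v i * q) w + outer w (fun i => v i * q) with hT
  set p : Fin n → ℍ[ℂ] := fun i => w i * star q with hp
  have hvp : outer v p + outer p v = T := by
    ext1 i j
    simp [hT, hp, outer, mul_assoc]
  have hpp : outer p p = N • outer w w := by
    ext1 i j
    simp only [hp, outer, Matrix.of_apply, Matrix.smul_apply, star_mul, star_star, mul_assoc]
    rw [← mul_assoc (star q), star_mul_self_eq_coe, coe_mul_eq_smul, mul_smul_comm]
  have hexp : outer (fun i => v i + t • (w i * star q)) (fun i => v i + t • (w i * star q)) =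
      outer v v + t • T + t ^ 2 • outer p p := by
    rw [← hvp]
    ext1 i j
    simp only [hp, outer, Matrix.of_apply, Matrix.add_apply, Matrix.smul_apply, star_add,
      star_smul_complex, mul_add, add_mul, smul_mul_assoc, mul_smul_comm, smul_smul, smul_add,
      pow_two]
    abel
  have hB : IsSelfDual (X + t • outer w w) := hX.add ((isSelfDual_outer w).smul t)
  obtain ⟨P, Q, S, E, hg⟩ := detC_discriminant_expansion h hB v p
  -- This second expansion shows that the half-difference giving the cross term does not depend on
  -- the multiple `t` of `w w^*` in the base point.
  obtain ⟨P', Q', S', E', hg'⟩ := detC_discriminant_expansion h hX (fun i => v i * q) w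
  rw [← hT] at hg'
  rw [hvp] at hg
  -- The form `(1, t, t ^ 2)` is a square, so its discriminant term drops out.
  have e0 := hg 1 t (t ^ 2)
  have e1 := hg 1 0 0
  have e2 := hg 0 0 1
  have e3 := hg 0 1 0
  have e4 := hg 0 (-1) 0
  have f3 := hg' 0 1 t
  have f4 := hg' 0 (-1) t
  have f5 := hg' 0 1 0
  have f6 := hg' 0 (-1) 0
  simp only [one_smul, zero_smul, add_zero, neg_smul, ← sub_eq_add_neg] at e0 e1 e2 e3 e4 f3 f4 f5 f6
  have a1 := h (X + outer v v) (hX.add (isSelfDual_outer v)) w t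
  have a2 := h X hX w t
  have a3 := h X hX w (t + N)
  rw [hpp, add_assoc X, ← add_smul] at e2
  rw [show X + t • outer w w + outer v v = X + outer v v + t • outer w w by abel] at e1
  rw [show X + t • outer w w + T = X + T + t • outer w w by abel] at e3
  rw [show X + t • outer w w - T = X - T + t • outer w w by abel] at e4
  rw [hexp, show X + t • outer w w + (outer v v + t • T + t ^ 2 • outer p p) =
    X + t • outer w w + outer v v + t • T + t ^ 2 • outer p p by abel, e0]
  linear_combination a1 - e1 + t ^ 2 * (a3 - a2 - e2) + t / 2 * (f3 - f4 - e3 + e4 - (f5 - f6))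

/-- In the expansion by the smallest index both summands are quadratic in `t`. Each leading
coefficient is `W 0 * star (W 0)` times `detC (X' + outer w w) - detC X'`, and the two cancel. -/
theorem affineRankOne (n : ℕ) : AffineRankOne n := by
  induction n with
  | zero =>
    intro X _ v t
    have : ∀ Y : Matrix (Fin 0) (Fin 0) ℍ[ℂ], Y = X := fun Y => Subsingleton.elim _ _
    rw [this (X + t • outer v v), this (X + outer v v)]
    ring
  | succ n ih =>
    intro X hX W t
    have key : ∃ a b : ℂ, ∀ t : ℂ, detC (X + t • outer W W) = a + t * b := by
      set X' := X.submatrix Fin.succ Fin.succ with hX'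
      set w : Fin n → ℍ[ℂ] := fun i => W i.succ with hw
      set v : Fin n → ℍ[ℂ] := fun i => X i.succ 0 with hv
      have hX'd : IsSelfDual X' := hX.submatrix _
      have step : ∀ t : ℂ, detC (X + t • outer W W) =
          ((X 0 0).re + t * (W 0 * star (W 0)).re + 1) * detC (X' + t • outer w w) -
            detC (X' + t • outer w w + outer (fun i => v i + t • (w i * star (W 0)))
              (fun i => v i + t • (w i * star (W 0)))) := by
        intro t
        rw [detC_succ_of_affine ih (hX.add ((isSelfDual_outer W).smul t))]
        rfl
      set q := detC (X' + outer w w) - detC X' with hq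
      set d := detC (X' + outer v v + outer w w) - detC (X' + outer v v) with hd
      set e := 1 / 2 * (detC (X' + (outer (fun i => v i * W 0) w + outer w fun i => v i * W 0)) -
          detC (X' - (outer (fun i => v i * W 0) w + outer w fun i => v i * W 0))) with he
      -- The coefficients of `1` and `t` that remain after the `t ^ 2` terms cancel.
      refine ⟨((X 0 0).re + 1) * detC X' - detC (X' + outer v v),
        ((X 0 0).re + 1) * q + (W 0 * star (W 0)).re * detC X' - d - e, fun t => ?_⟩
      rw [step, detC_add_outer_add ih hX'd, ih X' hX'd w t, ← hq, ← hd, ← he]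
      ring
    obtain ⟨a, b, hab⟩ := key
    have h0 := hab 0
    have h1 := hab 1
    simp only [zero_smul, add_zero, one_smul] at h0 h1
    rw [hab, h0, h1]
    ring

/-! ### Invariance under relabelling -/

/-- Two successive expansions, with `detC_add_outer_add` at `t = 1` for the perturbed minor. The
form is chosen so that exchanging `(a, v)` with `(b, w)` and `q` with `q^*` visibly preserves it. -/
theorem detC_succ_succ {n : ℕ} {X : Matrix (Fin (n + 2)) (Fin (n + 2)) ℍ[ℂ]} (hX : IsSelfDual X)
    {Z : Matrix (Fin n) (Fin n) ℍ[ℂ]}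
    (hZ : X.submatrix (fun i => i.succ.succ) (fun i => i.succ.succ) = Z) {v w : Fin n → ℍ[ℂ]}
    (hv : ∀ i, X i.succ.succ 1 = v i) (hw : ∀ i, X i.succ.succ 0 = w i) {a b : ℂ} {q : ℍ[ℂ]}
    (ha : (X 1 1).re = a) (hb : (X 0 0).re = b) (hq : X 1 0 = q) :
    detC X = ((a + 1) * (b + 1) - (q * star q).re) * detC Z - (b + 1) * detC (Z + outer v v) -
      (a + 1) * detC (Z + outer w w) + detC (Z + outer v v + outer w w) +
        1 / 2 * (detC (Z + (outer (fun i => v i * q) w + outer w fun i => v i * q)) -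
          detC (Z - (outer (fun i => v i * q) w + outer w fun i => v i * q))) := by
  have hZd : IsSelfDual Z := hZ ▸ hX.submatrix _
  have hY : IsSelfDual (X.submatrix Fin.succ Fin.succ) := hX.submatrix _
  have h1 := detC_succ_of_affine (affineRankOne _) hX
  have h2 := detC_succ_of_affine (affineRankOne _) hY
  have h3 := detC_succ_of_affine (affineRankOne _)
    (hY.add (isSelfDual_outer fun i => X i.succ 0))
  have h4 := detC_add_outer_add (affineRankOne _) hZd v w q 1
  rw [h1, hb, h2, h3]
  have e1 : (X.submatrix Fin.succ Fin.succ).submatrix Fin.succ Fin.succ = Z := hZ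
  have e2 : (fun i : Fin n => X.submatrix Fin.succ Fin.succ i.succ 0) = v := funext hv
  have e3 : (X.submatrix Fin.succ Fin.succ + outer (fun i => X i.succ 0) fun i => X i.succ 0).submatrix
      Fin.succ Fin.succ = Z + (1 : ℂ) • outer w w := by
    rw [← e1, one_smul]
    ext1 i j
    simp [outer, hw]
  have e4 : (fun i : Fin n => (X.submatrix Fin.succ Fin.succ +
      outer (fun i => X i.succ 0) fun i => X i.succ 0) i.succ 0) =
        fun i => v i + (1 : ℂ) • (w i * star q) := by
    funext i
    simp [outer, hv, hw, hq]
  have e5 : ((X.submatrix Fin.succ Fin.succ +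
      outer (fun i => X i.succ 0) fun i => X i.succ 0) 0 0).re = a + (q * star q).re := by
    simp [outer, ha, hq]
  have e6 : (X.submatrix Fin.succ Fin.succ 0 0).re = a := ha
  rw [e1, e2, e3, e4, e5, e6, h4, one_smul]
  ring

theorem detC_submatrix_swap {n : ℕ} {X : Matrix (Fin (n + 2)) (Fin (n + 2)) ℍ[ℂ]}
    (hX : IsSelfDual X) : detC (X.submatrix (Equiv.swap 0 1) (Equiv.swap 0 1)) = detC X := by
  have hs : ∀ i : Fin n, Equiv.swap (0 : Fin (n + 2)) 1 i.succ.succ = i.succ.succ := fun i =>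
    Equiv.swap_apply_of_ne_of_ne (Fin.succ_ne_zero _)
      (fun h => Fin.succ_ne_zero i (Fin.succ_injective _ h))
  rw [detC_succ_succ hX rfl (fun _ => rfl) (fun _ => rfl) rfl rfl rfl]
  rw [detC_succ_succ (hX.submatrix _)
    (Z := X.submatrix (fun i => i.succ.succ) (fun i => i.succ.succ))
    (v := fun i => X i.succ.succ 0) (w := fun i => X i.succ.succ 1) (a := (X 0 0).re)
    (b := (X 1 1).re) (q := star (X 1 0))]
  · have h1 : (outer (fun i : Fin n => X i.succ.succ 0 * star (X 1 0)) (fun i => X i.succ.succ 1) +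
        outer (fun i => X i.succ.succ 1) fun i => X i.succ.succ 0 * star (X 1 0)) =
        (outer (fun i => X i.succ.succ 1 * X 1 0) (fun i => X i.succ.succ 0) +
          outer (fun i => X i.succ.succ 0) fun i => X i.succ.succ 1 * X 1 0) := by
      ext1 i j
      simp only [outer, Matrix.add_apply, Matrix.of_apply, star_mul, star_star, mul_assoc]
      rw [add_comm]
    have h2 : (star (X 1 0) * star (star (X 1 0))).re = (X 1 0 * star (X 1 0)).re := by
      simp
    rw [h1, h2, add_right_comm _ (outer _ _) (outer _ _)]
    ring
  · ext1 i j
    simp [hs]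
  · intro i
    simp [hs]
  · intro i
    simp [hs]
  · simp
  · simp
  · simp [hX 1 0]

/-- `detC` is invariant under simultaneous permutations of rows and columns. -/
theorem detC_submatrix_perm {n : ℕ} {X : Matrix (Fin n) (Fin n) ℍ[ℂ]} (hX : IsSelfDual X)
    (e : Equiv.Perm (Fin n)) : detC (X.submatrix e e) = detC X := by
  induction n with
  | zero => congr 1; exact Subsingleton.elim _ _
  | succ n ih =>
    -- `X` is quantified inside because the product case applies the hypotheses to different
    -- matrices.
    have key : ∀ e : Equiv.Perm (Fin (n + 1)), ∀ X : Matrix (Fin (n + 1)) (Fin (n + 1)) ℍ[ℂ],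
        IsSelfDual X → detC (X.submatrix e e) = detC X := by
      intro e
      have he : e ∈ Submonoid.closure
          (Set.range fun i : Fin n => Equiv.swap i.castSucc i.succ) := by
        rw [Equiv.Perm.mclosure_swap_castSucc_succ]
        trivial
      induction he using Submonoid.closure_induction with
      | mem e he =>
        obtain ⟨i, rfl⟩ := he
        intro X hX
        cases n with
        | zero => exact i.elim0
        | succ n =>
          -- Only the transposition of `0` and `1` needs the double expansion. The others fix `0`
          -- and act on the minors of a single expansion, where the induction hypothesis applies.
          rcases Fin.eq_zero_or_eq_succ i with rfl | ⟨j, rfl⟩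
          · exact detC_submatrix_swap hX
          · set f : Equiv.Perm (Fin (n + 2)) :=
              Equiv.swap (j.succ.castSucc : Fin (n + 2)) j.succ.succ with hf
            have hf0 : f 0 = 0 := by
              refine Equiv.swap_apply_of_ne_of_ne ?_ ?_
              · rw [← Fin.succ_castSucc]
                exact (Fin.succ_ne_zero _).symm
              · exact (Fin.succ_ne_zero _).symm
            have hfs : ∀ k : Fin (n + 1), f k.succ = (Equiv.swap j.castSucc j.succ k).succ := by
              intro k
              rw [hf, ← Fin.succ_castSucc]
              exact ((Fin.succ_injective _).map_swap _ _ _).symm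
            rw [detC_succ_of_affine (affineRankOne _) (hX.submatrix f),
              detC_succ_of_affine (affineRankOne _) hX]
            have h1 : (X.submatrix f f).submatrix Fin.succ Fin.succ =
                (X.submatrix Fin.succ Fin.succ).submatrix (Equiv.swap j.castSucc j.succ)
                  (Equiv.swap j.castSucc j.succ) := by
              ext1 k l
              simp [hfs]
            have h2 : (X.submatrix f f).submatrix Fin.succ Fin.succ +
                outer (fun i => X.submatrix f f i.succ 0) (fun i => X.submatrix f f i.succ 0) =
                (X.submatrix Fin.succ Fin.succ +
                  outer (fun i => X i.succ 0) fun i => X i.succ 0).submatrix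
                  (Equiv.swap j.castSucc j.succ) (Equiv.swap j.castSucc j.succ) := by
              ext1 k l
              simp [hfs, hf0, outer]
            rw [h2, h1, ih (hX.submatrix _),
              ih ((hX.submatrix _).add (isSelfDual_outer _))]
            simp [hf0]
      | one => intro X _; simp
      | mul e f _ _ h1 h2 =>
        intro X hX
        have : X.submatrix (e * f) (e * f) = (X.submatrix e e).submatrix f f := by
          ext1 i j
          simp
        rw [this, h2 _ (hX.submatrix e), h1 X hX]
    exact key e X hX

/-! ### Multi-affine interpolation -/

/-- A function that is affine in every coordinate is interpolated from the vertices of the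
unit cube. -/
theorem eq_sum_powerset_of_affine {ι : Type*} [DecidableEq ι] (f : (ι → ℂ) → ℂ)
    (hf : ∀ c i t, f (Function.update c i t) = f (Function.update c i 0) +
      t * (f (Function.update c i 1) - f (Function.update c i 0))) (c : ι → ℂ) (s : Finset ι) :
    f c = ∑ I ∈ s.powerset, (∏ i ∈ I, c i) * (∏ i ∈ s \ I, (1 - c i)) *
      f (fun i => if i ∈ s then if i ∈ I then 1 else 0 else c i) := by
  induction s using Finset.induction_on with
  | empty => simp
  | insert a s ha ih =>
    rw [Finset.sum_powerset_insert ha, ih, ← Finset.sum_add_distrib]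
    refine Finset.sum_congr rfl fun I hI => ?_
    have haI : a ∉ I := fun h => ha (Finset.mem_powerset.1 hI h)
    set d : ι → ℂ := fun i => if i ∈ s then if i ∈ I then 1 else 0 else c i with hd
    have h0 : (fun i => if i ∈ insert a s then if i ∈ I then (1 : ℂ) else 0 else c i) =
        Function.update d a 0 := by
      funext i
      by_cases hi : i = a
      · subst hi; simp [haI]
      · simp [hi, hd]
    have h1 : (fun i => if i ∈ insert a s then if i ∈ insert a I then (1 : ℂ) else 0 else c i) =
        Function.update d a 1 := by
      funext i
      by_cases hi : i = a
      · subst hi; simp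
      · simp [hi, hd]
    have h2 : f d = f (Function.update d a 0) +
        c a * (f (Function.update d a 1) - f (Function.update d a 0)) := by
      rw [← hf d a (c a)]
      congr 1
      funext i
      by_cases hi : i = a
      · subst hi; simp [hd, ha]
      · simp [hi]
    rw [h0, h1, h2, Finset.prod_insert haI, Finset.insert_sdiff_of_notMem _ haI,
      Finset.prod_insert (fun h => ha (Finset.mem_sdiff.1 h).1)]
    have h3 : insert a s \ insert a I = s \ I := by
      ext i
      simp only [Finset.mem_sdiff, Finset.mem_insert]
      by_cases hi : i = a
      · subst hi; simp [ha]
      · simp [hi]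
    rw [h3]
    ring

/-- For `c_k ∈ [0, 1]` the right side is the expected determinant when each `k` is kept
independently with probability `c_k`. This is the algebraic core of the theorem. -/
theorem detC_sum_smul_outer {ι : Type*} [Fintype ι] [DecidableEq ι] {n : ℕ}
    (v : ι → Fin n → ℍ[ℂ]) (c : ι → ℂ) :
    detC (∑ k, c k • outer (v k) (v k)) = ∑ I : Finset ι, (∏ i ∈ I, c i) * (∏ i ∈ Iᶜ, (1 - c i)) *
      detC (∑ k ∈ I, outer (v k) (v k)) := by
  rw [eq_sum_powerset_of_affine (fun c => detC (∑ k, c k • outer (v k) (v k))) ?_ c Finset.univ]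
  · rw [Finset.powerset_univ]
    refine Finset.sum_congr rfl fun I _ => ?_
    congr 2
    simp [Finset.sum_ite_mem, ite_smul]
  · intro c i t
    have h : ∀ t : ℂ, ∑ k, Function.update c i t k • outer (v k) (v k) =
        ∑ k ∈ Finset.univ.erase i, c k • outer (v k) (v k) + t • outer (v i) (v i) := by
      intro t
      rw [← Finset.sum_erase_add _ _ (Finset.mem_univ i), Function.update_self]
      congr 1
      refine Finset.sum_congr rfl fun k hk => ?_
      rw [Function.update_of_ne (Finset.ne_of_mem_erase hk)]
    have hsd : ∀ s : Finset ι, IsSelfDual (∑ k ∈ s, c k • outer (v k) (v k)) := by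
      intro s
      induction s using Finset.induction_on with
      | empty => intro i j; simp
      | insert a s ha ih =>
        rw [Finset.sum_insert ha]
        exact ((isSelfDual_outer _).smul _).add ih
    simp only [h, zero_smul, add_zero, one_smul]
    exact affineRankOne n _ (hsd _) _ t

/-! ### Measurability and integrals of quaternion functions -/

theorem QMeasurable.add {α : Type*} [MeasurableSpace α] {f g : α → ℍ[ℂ]} (hf : QMeasurable f)
    (hg : QMeasurable g) : QMeasurable fun x => f x + g x :=
  ⟨hf.1.add hg.1, hf.2.1.add hg.2.1, hf.2.2.1.add hg.2.2.1, hf.2.2.2.add hg.2.2.2⟩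

theorem QMeasurable.mul {α : Type*} [MeasurableSpace α] {f g : α → ℍ[ℂ]} (hf : QMeasurable f)
    (hg : QMeasurable g) : QMeasurable fun x => f x * g x := by
  obtain ⟨f0, f1, f2, f3⟩ := hf
  obtain ⟨g0, g1, g2, g3⟩ := hg
  refine ⟨?_, ?_, ?_, ?_⟩
  · simp only [Quaternion.re_mul]
    fun_prop
  · simp only [Quaternion.imI_mul]
    fun_prop
  · simp only [Quaternion.imJ_mul]
    fun_prop
  · simp only [Quaternion.imK_mul]
    fun_prop

theorem QMeasurable.const {α : Type*} [MeasurableSpace α] (q : ℍ[ℂ]) :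
    QMeasurable fun _ : α => q :=
  ⟨measurable_const, measurable_const, measurable_const, measurable_const⟩

theorem QMeasurable.star {α : Type*} [MeasurableSpace α] {f : α → ℍ[ℂ]} (hf : QMeasurable f) :
    QMeasurable fun x => star (f x) := by
  obtain ⟨f0, f1, f2, f3⟩ := hf
  refine ⟨?_, ?_, ?_, ?_⟩ <;> simp only [Quaternion.re_star, Quaternion.imI_star,
    Quaternion.imJ_star, Quaternion.imK_star] <;> fun_prop

theorem QMeasurable.comp {α β : Type*} [MeasurableSpace α] [MeasurableSpace β] {f : β → ℍ[ℂ]}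
    (hf : QMeasurable f) {g : α → β} (hg : Measurable g) : QMeasurable fun x => f (g x) :=
  ⟨hf.1.comp hg, hf.2.1.comp hg, hf.2.2.1.comp hg, hf.2.2.2.comp hg⟩

theorem QMeasurable.sum {α ι : Type*} [MeasurableSpace α] {s : Finset ι} {f : ι → α → ℍ[ℂ]}
    (hf : ∀ i ∈ s, QMeasurable (f i)) : QMeasurable fun x => ∑ i ∈ s, f i x := by
  classical
  induction s using Finset.induction_on with
  | empty => simpa using QMeasurable.const 0
  | insert i s hi ih =>
    simp only [Finset.sum_insert hi]
    exact (hf i (Finset.mem_insert_self _ _)).add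
      (ih fun j hj => hf j (Finset.mem_insert_of_mem hj))

theorem QMeasurable.list_prod {α ι : Type*} [MeasurableSpace α] (l : List ι) {f : ι → α → ℍ[ℂ]}
    (hf : ∀ i, QMeasurable (f i)) : QMeasurable fun x => (l.map fun i => f i x).prod := by
  induction l with
  | nil => simpa using QMeasurable.const 1
  | cons i l ih =>
    simp only [List.map_cons, List.prod_cons]
    exact (hf i).mul ih

theorem QMeasurable.detM {α : Type*} [MeasurableSpace α] {n : ℕ}
    {X : α → Matrix (Fin n) (Fin n) ℍ[ℂ]} (hX : ∀ i j, QMeasurable fun x => X x i j) :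
    QMeasurable fun x => detM (X x) := by
  simp only [detM_eq_sum_cycleList, zsmul_eq_mul]
  exact QMeasurable.sum fun σ _ =>
    (QMeasurable.const _).mul (QMeasurable.list_prod _ fun i => hX i (σ i))

/-- The quaternion unit `i`. -/
def unitI : ℍ[ℂ] := ⟨0, 1, 0, 0⟩

/-- The quaternion unit `j`. -/
def unitJ : ℍ[ℂ] := ⟨0, 0, 1, 0⟩

/-- The quaternion unit `k`. -/
def unitK : ℍ[ℂ] := ⟨0, 0, 0, 1⟩

theorem linearMap_quaternion_apply (T : ℍ[ℂ] →ₗ[ℂ] ℂ) (q : ℍ[ℂ]) :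
    T q = q.re * T 1 + q.imI * T unitI + q.imJ * T unitJ + q.imK * T unitK := by
  have h : q = q.re • (1 : ℍ[ℂ]) + q.imI • unitI + q.imJ • unitJ + q.imK • unitK := by
    ext <;> simp only [Quaternion.re_add, Quaternion.imI_add, Quaternion.imJ_add,
      Quaternion.imK_add, Quaternion.re_smul, Quaternion.imI_smul, Quaternion.imJ_smul,
      Quaternion.imK_smul] <;> simp [unitI, unitJ, unitK]
  have h2 := congrArg T h
  rwa [map_add, map_add, map_add, map_smul, map_smul, map_smul, map_smul] at h2

theorem integrable_and_integral_linear_combination {α : Type*} [MeasurableSpace α]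
    {μ : Measure α} {f g h k : α → ℂ} (hf : Integrable f μ) (hg : Integrable g μ)
    (hh : Integrable h μ) (hk : Integrable k μ) (a b c d : ℂ) :
    Integrable (fun x => f x * a + g x * b + h x * c + k x * d) μ ∧
      ∫ x, f x * a + g x * b + h x * c + k x * d ∂μ =
        (∫ x, f x ∂μ) * a + (∫ x, g x ∂μ) * b + (∫ x, h x ∂μ) * c + (∫ x, k x ∂μ) * d := by
  have h1 := hf.mul_const a
  have h2 := hg.mul_const b
  have h3 := hh.mul_const c
  have h4 := hk.mul_const d
  refine ⟨((h1.add h2).add h3).add h4, ?_⟩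
  have e1 : ∫ x, f x * a + g x * b + h x * c + k x * d ∂μ =
      ∫ x, f x * a + g x * b + h x * c ∂μ + ∫ x, k x * d ∂μ :=
    integral_add ((h1.add h2).add h3) h4
  have e2 : ∫ x, f x * a + g x * b + h x * c ∂μ =
      ∫ x, f x * a + g x * b ∂μ + ∫ x, h x * c ∂μ := integral_add (h1.add h2) h3
  rw [e1, e2, integral_add h1 h2]
  simp only [integral_mul_const]

theorem QIntegrable.linearMap {α : Type*} [MeasurableSpace α] {μ : Measure α} {f : α → ℍ[ℂ]}
    (hf : QIntegrable f μ) (T : ℍ[ℂ] →ₗ[ℂ] ℂ) : Integrable (fun x => T (f x)) μ := by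
  rw [funext fun x => linearMap_quaternion_apply T (f x)]
  exact (integrable_and_integral_linear_combination hf.1 hf.2.1 hf.2.2.1 hf.2.2.2 _ _ _ _).1

theorem integral_linearMap {α : Type*} [MeasurableSpace α] {μ : Measure α} {f : α → ℍ[ℂ]}
    (hf : QIntegrable f μ) (T : ℍ[ℂ] →ₗ[ℂ] ℂ) : ∫ x, T (f x) ∂μ = T (qIntegral f μ) := by
  rw [funext fun x => linearMap_quaternion_apply T (f x),
    linearMap_quaternion_apply T (qIntegral f μ)]
  exact (integrable_and_integral_linear_combination hf.1 hf.2.1 hf.2.2.1 hf.2.2.2 _ _ _ _).2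

/-! ### Integrating out one point -/

/-- The projection kernel `K_I`. -/
def projKernel {Λ : Type*} {r : ℕ} (u : Fin r → Λ → ℍ[ℂ]) (I : Finset (Fin r)) (x y : Λ) : ℍ[ℂ] :=
  ∑ i ∈ I, u i x * star (u i y)

theorem kernelMatrix_projKernel {Λ : Type*} {r : ℕ} (u : Fin r → Λ → ℍ[ℂ]) (I : Finset (Fin r))
    {m : ℕ} (x : Fin m → Λ) : kernelMatrix (projKernel u I) x =
      ∑ k ∈ I, outer (fun i => u k (x i)) (fun i => u k (x i)) := by
  ext1 i j
  simp [kernelMatrix, projKernel, outer, Matrix.sum_apply]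

theorem isSelfDual_projKernel {Λ : Type*} {r : ℕ} (u : Fin r → Λ → ℍ[ℂ]) (I : Finset (Fin r))
    {m : ℕ} (x : Fin m → Λ) : IsSelfDual (kernelMatrix (projKernel u I) x) := by
  intro i j
  simp [kernelMatrix, projKernel]

/-- The scalar part of the derivative of the Moore-Dyson determinant as a linear form. -/
noncomputable def detMDerivLinear {n : ℕ} (X : Matrix (Fin n) (Fin n) ℍ[ℂ]) :
    Matrix (Fin n) (Fin n) ℍ[ℂ] →ₗ[ℂ] ℂ where
  toFun Y := (detMDeriv X Y).re
  map_add' Y Z := by rw [detMDeriv_add, Quaternion.re_add]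
  map_smul' c Y := by rw [detMDeriv_smul, Quaternion.re_smul, RingHom.id_apply]

/-- The linear map `q ↦ v q w^*`. -/
def sandwich {n : ℕ} (v w : Fin n → ℍ[ℂ]) : ℍ[ℂ] →ₗ[ℂ] Matrix (Fin n) (Fin n) ℍ[ℂ] where
  toFun q := Matrix.of fun i j => v i * q * star (w j)
  map_add' p q := by
    ext1 i j
    simp [mul_add, add_mul]
  map_smul' c q := by
    ext1 i j
    simp

/-- The linear form `re`. -/
def reLinear : ℍ[ℂ] →ₗ[ℂ] ℂ where
  toFun q := q.re
  map_add' _ _ := rfl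
  map_smul' _ _ := rfl

theorem re_mul_comm (p q : ℍ[ℂ]) : (p * q).re = (q * p).re := by
  simp only [Quaternion.re_mul]
  ring

/-- With the new point at index `0`, the expansion is linear in the products `u_k(y)^* u_l(y)`,
whose integrals orthonormality prescribes. -/
theorem detC_projKernel_cons {Λ : Type*} {r : ℕ}
    (u : Fin r → Λ → ℍ[ℂ]) (I : Finset (Fin r)) {m : ℕ} (x : Fin m → Λ)
    (y : Λ) : detC (kernelMatrix (projKernel u I) (Fin.cons y x : Fin (m + 1) → Λ)) =
      detC (kernelMatrix (projKernel u I) x) * ∑ k ∈ I, reLinear (star (u k y) * u k y) -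
        ∑ k ∈ I, ∑ l ∈ I, ((detMDerivLinear (kernelMatrix (projKernel u I) x)).comp
          (sandwich (fun i => u k (x i)) fun i => u l (x i))) (star (u k y) * u l y) := by
  rw [detC_succ (isSelfDual_projKernel u I _)]
  congr 1
  · congr 1
    simp only [kernelMatrix, Matrix.of_apply, Fin.cons_zero, projKernel]
    refine (map_sum reLinear _ _).trans (Finset.sum_congr rfl fun k _ => ?_)
    exact re_mul_comm _ _
  · simp only [LinearMap.comp_apply, ← map_sum]
    change detMDerivLinear (kernelMatrix (projKernel u I) x) _ = _
    congr 1
    ext1 i j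
    simp only [outer, kernelMatrix, Matrix.of_apply, Fin.cons_succ, Fin.cons_zero, projKernel,
      Matrix.sum_apply, sandwich, LinearMap.coe_mk, AddHom.coe_mk, star_sum, star_mul, star_star,
      Finset.sum_mul, Finset.mul_sum, mul_assoc]
    exact Finset.sum_comm

theorem integrable_detC_projKernel_cons {Λ : Type*} [MeasurableSpace Λ] {μ : Measure Λ} {r : ℕ}
    {u : Fin r → Λ → ℍ[ℂ]}
    (hu : IsOrthonormalSystem μ u) (I : Finset (Fin r)) {m : ℕ}
    (x : Fin m → Λ) :
    Integrable (fun y => detC (kernelMatrix (projKernel u I) (Fin.cons y x : Fin (m + 1) → Λ)))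
      μ := by
  simp only [detC_projKernel_cons]
  refine ((integrable_finsetSum _ fun k _ => (hu.integrable k k).linearMap _).const_mul _).sub ?_
  exact integrable_finsetSum _ fun k _ => integrable_finsetSum _ fun l _ =>
    (hu.integrable k l).linearMap _

/-- The diagonal term contributes `#I`. In the double sum only `k = l` survives, leaving the
derivative of the determinant in the direction of the kernel matrix itself, which is `m` times the
determinant by Euler's identity. -/
theorem integral_detC_projKernel_cons {Λ : Type*} [MeasurableSpace Λ] {μ : Measure Λ} {r : ℕ}
    {u : Fin r → Λ → ℍ[ℂ]}
    (hu : IsOrthonormalSystem μ u) (I : Finset (Fin r)) {m : ℕ}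
    (x : Fin m → Λ) :
    ∫ y, detC (kernelMatrix (projKernel u I) (Fin.cons y x : Fin (m + 1) → Λ)) ∂μ =
      (I.card - m) * detC (kernelMatrix (projKernel u I) x) := by
  simp only [detC_projKernel_cons]
  rw [integral_sub
    ((integrable_finsetSum _ fun k _ => (hu.integrable k k).linearMap _).const_mul _)
    (integrable_finsetSum _ fun k _ => integrable_finsetSum _ fun l _ =>
      (hu.integrable k l).linearMap _), integral_const_mul,
    integral_finsetSum _ fun k _ => (hu.integrable k k).linearMap _,
    integral_finsetSum _ fun k _ => integrable_finsetSum _ fun l _ =>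
      (hu.integrable k l).linearMap _]
  have h1 : ∀ k ∈ I, ∫ y, ∑ l ∈ I, ((detMDerivLinear (kernelMatrix (projKernel u I) x)).comp
      (sandwich (fun i => u k (x i)) fun i => u l (x i))) (star (u k y) * u l y) ∂μ =
      detMDerivLinear (kernelMatrix (projKernel u I) x)
        (outer (fun i => u k (x i)) (fun i => u k (x i))) := by
    intro k hk
    rw [integral_finsetSum _ fun l _ => (hu.integrable k l).linearMap _]
    rw [Finset.sum_eq_single k]
    · rw [integral_linearMap (hu.integrable k k), hu.integral_eq, if_pos rfl, LinearMap.comp_apply]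
      congr 1
      ext1 i j
      simp [sandwich, outer]
    · intro l _ hl
      rw [integral_linearMap (hu.integrable k l), hu.integral_eq, if_neg hl.symm, map_zero]
    · exact fun h => absurd hk h
  have h2 : ∀ k ∈ I, ∫ y, reLinear (star (u k y) * u k y) ∂μ = 1 := by
    intro k _
    rw [integral_linearMap (hu.integrable k k), hu.integral_eq, if_pos rfl]
    rfl
  rw [Finset.sum_congr rfl h1, Finset.sum_congr rfl h2, ← map_sum, ← kernelMatrix_projKernel]
  simp only [detMDerivLinear, LinearMap.coe_mk, AddHom.coe_mk, detMDeriv_self, Finset.sum_const,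
    nsmul_eq_mul, mul_one]
  have h3 : ((m : ℍ[ℂ]) * detM (kernelMatrix (projKernel u I) x)).re =
      m * detC (kernelMatrix (projKernel u I) x) := by
    rw [← nsmul_eq_mul]
    exact (map_nsmul reLinear m _).trans (nsmul_eq_mul _ _)
  rw [h3]
  ring

/-! ### The correlation functions of the projection kernels -/

/-- The correlation function of the kernel `K_I`. -/
noncomputable def projCorrelation {Λ : Type*} {r : ℕ} (u : Fin r → Λ → ℍ[ℂ]) (I : Finset (Fin r))
    (m : ℕ) (x : Fin m → Λ) : ℝ≥0 :=
  (detC (kernelMatrix (projKernel u I) x)).re.toNNReal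

theorem coe_projCorrelation {Λ : Type*} {r : ℕ} {u : Fin r → Λ → ℍ[ℂ]}
    (hpos : IsCompletelyPositive u) (I : Finset (Fin r)) {m : ℕ}
    (x : Fin m → Λ) : ((projCorrelation u I m x : ℝ) : ℂ) =
      detC (kernelMatrix (projKernel u I) x) := by
  -- Positivity is assumed only for `m ≥ 1`; the empty determinant is `1`.
  rcases Nat.eq_zero_or_pos m with rfl | hm
  · rw [projCorrelation, detC, detM_zero_dim]
    simp
  · obtain ⟨a, ha, h⟩ := hpos I m x hm
    have h' : detM (kernelMatrix (projKernel u I) x) = ofRealQ a := h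
    rw [projCorrelation, detC, h']
    simp [ofRealQ, ha]

theorem ofRealQ_projCorrelation {Λ : Type*} {r : ℕ} {u : Fin r → Λ → ℍ[ℂ]}
    (hpos : IsCompletelyPositive u) (I : Finset (Fin r)) {m : ℕ}
    (x : Fin m → Λ) : ofRealQ (projCorrelation u I m x) =
      detM (kernelMatrix (projKernel u I) x) := by
  rw [detM_eq_coe_re (isSelfDual_projKernel u I x), ofRealQ, coe_projCorrelation hpos, detC]

theorem measurable_projCorrelation {Λ : Type*} [MeasurableSpace Λ] {r : ℕ}
    {u : Fin r → Λ → ℍ[ℂ]}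
    (hu : ∀ k, QMeasurable (u k)) (I : Finset (Fin r)) (m : ℕ) :
    Measurable (projCorrelation u I m) := by
  refine (Complex.measurable_re.comp ?_).real_toNNReal
  refine (QMeasurable.detM (X := fun x => kernelMatrix (projKernel u I) x) fun i j => ?_).1
  exact QMeasurable.sum fun k _ => ((hu k).comp (measurable_pi_apply i)).mul
    ((hu k).comp (measurable_pi_apply j)).star

theorem projCorrelation_comp_perm {Λ : Type*} {r : ℕ} (u : Fin r → Λ → ℍ[ℂ])
    (I : Finset (Fin r)) {m : ℕ} (x : Fin m → Λ) (e : Equiv.Perm (Fin m)) :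
    projCorrelation u I m (x ∘ e) = projCorrelation u I m x := by
  rw [projCorrelation, projCorrelation, ← detC_submatrix_perm (isSelfDual_projKernel u I x) e]
  rfl

theorem integral_projCorrelation_cons {Λ : Type*} [MeasurableSpace Λ] {μ : Measure Λ} {r : ℕ}
    {u : Fin r → Λ → ℍ[ℂ]} (hu : IsOrthonormalSystem μ u) (hpos : IsCompletelyPositive u)
    (I : Finset (Fin r)) {m : ℕ} (x : Fin m → Λ) :
    ∫ y, (projCorrelation u I (m + 1) (Fin.cons y x : Fin (m + 1) → Λ) : ℝ) ∂μ =
      ((I.card : ℝ) - m) * projCorrelation u I m x := by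
  have hval := integral_detC_projKernel_cons hu I x
  simp only [← coe_projCorrelation hpos] at hval
  rw [integral_complex_ofReal] at hval
  exact_mod_cast hval

/-- The integral of the next correlation function is nonnegative, yet it equals a negative multiple
of this nonnegative value. -/
theorem projCorrelation_eq_zero {Λ : Type*} [MeasurableSpace Λ] {μ : Measure Λ} {r : ℕ}
    {u : Fin r → Λ → ℍ[ℂ]} (hu : IsOrthonormalSystem μ u) (hpos : IsCompletelyPositive u)
    (I : Finset (Fin r)) {m : ℕ} (hm : I.card < m) (x : Fin m → Λ) :
    projCorrelation u I m x = 0 := by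
  have hnn : 0 ≤ ((I.card : ℝ) - m) * projCorrelation u I m x := by
    rw [← integral_projCorrelation_cons hu hpos]
    exact integral_nonneg fun y => NNReal.coe_nonneg _
  have h1 : ((I.card : ℝ) - m) < 0 := sub_neg.2 (by exact_mod_cast hm)
  exact NNReal.coe_eq_zero.1 (le_antisymm (by nlinarith) (NNReal.coe_nonneg _))

/-- The truncated subtraction is harmless: for `m > #I` the correlation function vanishes. -/
theorem lintegral_projCorrelation_cons {Λ : Type*} [MeasurableSpace Λ] {μ : Measure Λ} {r : ℕ}
    {u : Fin r → Λ → ℍ[ℂ]} (hu : IsOrthonormalSystem μ u) (hpos : IsCompletelyPositive u)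
    (I : Finset (Fin r)) {m : ℕ} (x : Fin m → Λ) :
    ∫⁻ y, (projCorrelation u I (m + 1) (Fin.cons y x) : ℝ≥0∞) ∂μ =
      ((I.card - m : ℕ) : ℝ≥0∞) * projCorrelation u I m x := by
  have hint := integrable_detC_projKernel_cons hu I x
  simp only [← coe_projCorrelation hpos] at hint
  have hint' : Integrable
      (fun y => (projCorrelation u I (m + 1) (Fin.cons y x : Fin (m + 1) → Λ) : ℝ)) μ := hint.re
  have hl := ofReal_integral_eq_lintegral_ofReal hint'
    (Filter.Eventually.of_forall fun y => NNReal.coe_nonneg _)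
  simp only [ENNReal.ofReal_coe_nnreal] at hl
  rw [← hl, integral_projCorrelation_cons hu hpos]
  rcases le_or_gt m I.card with h | h
  · rw [← Nat.cast_sub h, ENNReal.ofReal_mul (Nat.cast_nonneg _), ENNReal.ofReal_natCast,
      ENNReal.ofReal_coe_nnreal]
  · simp [projCorrelation_eq_zero hu hpos I h]

/-! ### Marginals -/

theorem lintegral_pi_fin_succ {Λ : Type*} [MeasurableSpace Λ] {μ : Measure Λ}
    [SigmaFinite μ] {n : ℕ} {F : (Fin (n + 1) → Λ) → ℝ≥0∞}
    (hF : Measurable F) : ∫⁻ x, F x ∂(Measure.pi fun _ => μ) =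
      ∫⁻ x, ∫⁻ y, F (Fin.cons y x) ∂μ ∂(Measure.pi fun _ : Fin n => μ) := by
  have h := (measurePreserving_piFinSuccAbove (fun _ : Fin (n + 1) => μ) 0).symm
  rw [← h.lintegral_comp hF]
  refine (lintegral_prod_symm _ (hF.comp h.measurable).aemeasurable).trans ?_
  simp [MeasurableEquiv.piFinSuccAbove, Fin.insertNthEquiv]

theorem lintegral_pi_comp_perm {Λ : Type*} [MeasurableSpace Λ] {μ : Measure Λ}
    [SigmaFinite μ] {n : ℕ} (e : Equiv.Perm (Fin n))
    (F : (Fin n → Λ) → ℝ≥0∞) : ∫⁻ x, F (x ∘ e) ∂(Measure.pi fun _ => μ) =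
      ∫⁻ x, F x ∂(Measure.pi fun _ => μ) := by
  have h := measurePreserving_piCongrLeft (fun _ : Fin n => μ) e.symm
  rw [← h.lintegral_comp_emb (MeasurableEquiv.measurableEmbedding _) F]
  refine lintegral_congr fun x => ?_
  congr 1
  funext i
  rw [Function.comp_apply]
  have := MeasurableEquiv.piCongrLeft_apply_apply (β := fun _ : Fin n => Λ) e.symm x (e i)
  rw [Equiv.symm_apply_apply] at this
  exact this.symm

/-- The `n - k` coordinates outside the range of `φ` are integrated out one by one, and their
factors multiply to the falling factorial. -/
theorem lintegral_comp_embedding_mul {Λ : Type*} [MeasurableSpace Λ] {μ : Measure Λ} {r : ℕ}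
    {u : Fin r → Λ → ℍ[ℂ]}
    [SigmaFinite μ] (hu : IsOrthonormalSystem μ u)
    (hpos : IsCompletelyPositive u) (I : Finset (Fin r)) {k n : ℕ} (φ : Fin k ↪ Fin n)
    {g : (Fin k → Λ) → ℝ≥0∞} (hg : Measurable g) :
    ∫⁻ x, g (x ∘ φ) * projCorrelation u I n x ∂(Measure.pi fun _ => μ) =
      ((I.card - k).descFactorial (n - k) : ℝ≥0∞) *
        ∫⁻ x, g x * projCorrelation u I k x ∂(Measure.pi fun _ => μ) := by
  have hbij : ∀ {k n : ℕ} (φ : Fin k ↪ Fin n) {g : (Fin k → Λ) → ℝ≥0∞},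
      Function.Surjective φ → ∫⁻ x, g (x ∘ φ) * projCorrelation u I n x ∂(Measure.pi fun _ => μ) =
      ((I.card - k).descFactorial (n - k) : ℝ≥0∞) *
        ∫⁻ x, g x * projCorrelation u I k x ∂(Measure.pi fun _ => μ) := by
    intro k n φ g hs
    have hkn : k = n := by
      simpa using Fintype.card_of_bijective ⟨φ.injective, hs⟩
    subst hkn
    set e : Equiv.Perm (Fin k) := Equiv.ofBijective φ ⟨φ.injective, hs⟩ with he
    have := lintegral_pi_comp_perm (μ := μ) e (fun x => g x * projCorrelation u I k x)
    simp only [projCorrelation_comp_perm] at this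
    rw [show (e : Fin k → Fin k) = φ from rfl] at this
    simpa using this
  induction n with
  | zero => exact hbij φ fun i => i.elim0
  | succ n ih =>
    by_cases hs : Function.Surjective φ
    · exact hbij φ hs
    · simp only [Function.Surjective, not_forall] at hs
      obtain ⟨j, hj⟩ := hs
      -- By symmetry the unused coordinate `j` may be moved to position `0`, where it can be
      -- integrated out.
      have hne : ∀ i, Equiv.swap 0 j (φ i) ≠ 0 := by
        intro i h
        rw [Equiv.swap_apply_eq_iff, Equiv.swap_apply_left] at h
        exact hj ⟨i, h⟩
      set ψ : Fin k ↪ Fin n := ⟨fun i => (Equiv.swap 0 j (φ i)).pred (hne i), fun a b hab => by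
        simpa using hab⟩ with hψ
      have hψs : ∀ i, (ψ i).succ = Equiv.swap 0 j (φ i) := fun i => Fin.succ_pred _ (hne i)
      have hmeas : Measurable (fun x : Fin (n + 1) → Λ =>
          g (fun i => x (ψ i).succ) * projCorrelation u I (n + 1) x) := by
        refine (hg.comp ?_).mul (measurable_projCorrelation hu.measurable I _).coe_nnreal_ennreal
        exact measurable_pi_lambda _ fun i => measurable_pi_apply _
      have h1 : ∫⁻ x, g (x ∘ φ) * projCorrelation u I (n + 1) x ∂(Measure.pi fun _ => μ) =
          ∫⁻ x : Fin (n + 1) → Λ, g (fun i => x (ψ i).succ) * projCorrelation u I (n + 1) x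
            ∂(Measure.pi fun _ => μ) := by
        rw [← lintegral_pi_comp_perm (Equiv.swap 0 j)]
        refine lintegral_congr fun x => ?_
        rw [projCorrelation_comp_perm]
        congr 2
        funext i
        simp [hψs]
      have hle : k ≤ n := by simpa using Fintype.card_le_of_embedding ψ
      rw [h1, lintegral_pi_fin_succ hmeas]
      have h2 : ∀ x : Fin n → Λ, ∫⁻ y, g (fun i => (Fin.cons y x : Fin (n + 1) → Λ) (ψ i).succ) *
          projCorrelation u I (n + 1) (Fin.cons y x) ∂μ =
          ((I.card - n : ℕ) : ℝ≥0∞) * (g (x ∘ ψ) * projCorrelation u I n x) := by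
        intro x
        simp only [Fin.cons_succ]
        rw [lintegral_const_mul, lintegral_projCorrelation_cons hu hpos]
        · simp only [Function.comp_def]
          ring
        · refine (measurable_projCorrelation hu.measurable I _).coe_nnreal_ennreal.comp ?_
          refine measurable_pi_lambda _ fun i => ?_
          rcases Fin.eq_zero_or_eq_succ i with rfl | ⟨i, rfl⟩
          · exact measurable_id
          · exact measurable_const
      simp only [h2]
      rw [lintegral_const_mul, ih ψ, ← mul_assoc, Nat.succ_sub hle, Nat.descFactorial_succ,
        Nat.cast_mul, show I.card - k - (n - k) = I.card - n by omega]
      refine Measurable.mul (hg.comp ?_)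
        (measurable_projCorrelation hu.measurable I _).coe_nnreal_ennreal
      exact measurable_pi_lambda _ fun i => measurable_pi_apply _

/-! ### Falling factorials and embeddings -/

theorem fallingFactorial_natCast (n k : ℕ) :
    fallingFactorial (n : ℝ≥0∞) k = (n.descFactorial k : ℝ≥0∞) := by
  rw [fallingFactorial, Nat.descFactorial_eq_prod_range, Nat.cast_prod]
  exact Finset.prod_congr rfl fun j _ => (ENNReal.natCast_sub n j).symm

open scoped Classical in
/-- The number of injective choices of points, the `l`-th one in the class `b l`, when every
point lies in at most one class. -/
theorem sum_embedding_eq_prod_descFactorial {α ι : Type*} [Fintype α] [Fintype ι]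
    (P : α → ι → Prop) (hP : ∀ j i i', P j i → P j i' → i = i') {k : ℕ} (b : Fin k → ι) :
    (∑ φ : Fin k ↪ α, if ∀ l, P (φ l) (b l) then 1 else 0) =
      ∏ i, (Finset.univ.filter fun j => P j i).card.descFactorial
        (Finset.univ.filter fun l => b l = i).card := by
  induction k with
  | zero => simp
  | succ k ih =>
    rw [← (Equiv.embeddingFinSucc k α).symm.sum_comp, Fintype.sum_sigma]
    -- Once the other points are chosen, the first may be any unused point of its class. As classes
    -- are disjoint, the used points of that class are exactly those assigned to it.
    have inner : ∀ e : Fin k ↪ α, (∑ j : {i // i ∉ Set.range e},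
        if ∀ l, P ((Equiv.embeddingFinSucc k α).symm ⟨e, j⟩ l) (b l) then 1 else 0) =
        (if ∀ l, P (e l) (b l.succ) then 1 else 0) *
          ((Finset.univ.filter fun j => P j (b 0)).card -
            (Finset.univ.filter fun l : Fin k => b l.succ = b 0).card) := by
      intro e
      simp only [Equiv.coe_embeddingFinSucc_symm, Fin.forall_fin_succ, Fin.cons_zero, Fin.cons_succ]
      by_cases he : ∀ l, P (e l) (b l.succ)
      · simp only [he, implies_true, and_true, if_true, one_mul]
        rw [← Finset.card_filter]
        have h1 : (Finset.univ.filter fun l : Fin k => b l.succ = b 0).card =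
            ((Finset.univ.filter fun l : Fin k => b l.succ = b 0).map e).card := by
          rw [Finset.card_map]
        have h2 : (Finset.univ.filter fun l : Fin k => b l.succ = b 0).map e ⊆
            Finset.univ.filter fun j => P j (b 0) := by
          intro j hj
          simp only [Finset.mem_map, Finset.mem_filter, Finset.mem_univ, true_and] at hj ⊢
          obtain ⟨l, hl, rfl⟩ := hj
          rw [← hl]
          exact he l
        rw [h1, ← Finset.card_sdiff_of_subset h2]
        rw [← Finset.card_map (Function.Embedding.subtype _)]
        congr 1
        ext j
        simp only [Finset.mem_map, Finset.mem_filter, Finset.mem_univ, true_and,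
          Function.Embedding.subtype_apply, Subtype.exists, Finset.mem_sdiff, Set.mem_range]
        constructor
        · rintro ⟨j, hj, hjP, rfl⟩
          exact ⟨hjP, fun ⟨l, _, hl⟩ => hj ⟨l, hl⟩⟩
        · rintro ⟨hjP, hj⟩
          refine ⟨j, ?_, hjP, rfl⟩
          rintro ⟨l, rfl⟩
          exact hj ⟨l, hP _ _ _ (he l) hjP, rfl⟩
      · simp [he]
    simp only [inner]
    rw [← Finset.sum_mul, ih (fun l => b l.succ), ← Finset.prod_erase_mul _ _ (Finset.mem_univ (b 0)),
      ← Finset.prod_erase_mul _ _ (Finset.mem_univ (b 0))]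
    have hc : ∀ i, (Finset.univ.filter fun l => b l = i).card =
        (if b 0 = i then 1 else 0) + (Finset.univ.filter fun l : Fin k => b l.succ = i).card := by
      intro i
      simp only [Finset.card_filter, Fin.sum_univ_succ]
    rw [mul_assoc]
    congr 1
    · refine Finset.prod_congr rfl fun i hi => ?_
      rw [hc i, if_neg (Finset.ne_of_mem_erase hi).symm, zero_add]
    · rw [hc (b 0), if_pos rfl, add_comm 1, Nat.descFactorial_succ, mul_comm]

/-! ### Finite configurations -/

open scoped Classical in
/-- The configuration of the points `x 0, …, x (n - 1)`. -/
noncomputable def pointConfiguration {Λ : Type*} [TopologicalSpace Λ] {n : ℕ} (x : Fin n → Λ) :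
    Configuration Λ where
  mult y := ∑ i, if x i = y then 1 else 0
  countable_support := by
    refine (Set.finite_range x).countable.mono fun y hy => ?_
    obtain ⟨i, -, hi⟩ := Finset.exists_ne_zero_of_sum_ne_zero hy
    exact ⟨i, by by_contra h; simp [h] at hi⟩
  finite_inter C _ := by
    refine (Set.finite_range x).subset fun y hy => ?_
    obtain ⟨i, -, hi⟩ := Finset.exists_ne_zero_of_sum_ne_zero hy.2
    exact ⟨i, by by_contra h; simp [h] at hi⟩

open scoped Classical in
theorem count_pointConfiguration {Λ : Type*} [TopologicalSpace Λ] {n : ℕ} (A : Set Λ)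
    (x : Fin n → Λ) : (pointConfiguration x).count A =
      ((Finset.univ.filter fun i => x i ∈ A).card : ℝ≥0∞) := by
  rw [Configuration.count, tsum_subtype A fun y => ((pointConfiguration x).mult y : ℝ≥0∞)]
  have h : ∀ y, A.indicator (fun y => ((pointConfiguration x).mult y : ℝ≥0∞)) y =
      ∑ i, if y = x i then (if x i ∈ A then (1 : ℝ≥0∞) else 0) else 0 := by
    intro y
    by_cases hy : y ∈ A
    · simp only [Set.indicator_of_mem hy, pointConfiguration, Nat.cast_sum]
      refine Finset.sum_congr rfl fun i _ => ?_
      by_cases hi : x i = y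
      · subst hi; simp [hy]
      · simp [hi, Ne.symm hi]
    · rw [Set.indicator_of_notMem hy]
      refine (Finset.sum_eq_zero fun i _ => ?_).symm
      by_cases hi : y = x i
      · subst hi; simp [hy]
      · simp [hi]
  simp only [h]
  rw [Summable.tsum_finsetSum fun i _ => ENNReal.summable]
  simp

theorem Configuration.measurable_count {Λ : Type*} [TopologicalSpace Λ] [MeasurableSpace Λ]
    {A : Set Λ} (hA : MeasurableSet A) : Measurable (Configuration.count (Λ := Λ) A) :=
  measurable_iff_comap_le.2 (le_iSup₂ (f := fun (A : Set Λ) (_ : MeasurableSet A) =>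
    MeasurableSpace.comap (Configuration.count A) inferInstance) A hA)

theorem measurable_pointConfiguration {Λ : Type*} [TopologicalSpace Λ] [MeasurableSpace Λ] {n : ℕ} :
    Measurable (pointConfiguration : (Fin n → Λ) → Configuration Λ) := by
  classical
  rw [measurable_iff_comap_le, Configuration.instMeasurableSpace, MeasurableSpace.comap_iSup]
  refine iSup_le fun A => ?_
  rw [MeasurableSpace.comap_iSup]
  refine iSup_le fun hA => ?_
  rw [MeasurableSpace.comap_comp, ← measurable_iff_comap_le]
  have : Configuration.count A ∘ (pointConfiguration : (Fin n → Λ) → Configuration Λ) =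
      fun x => ∑ i, A.indicator 1 (x i) := by
    funext x
    rw [Function.comp_apply, count_pointConfiguration, Finset.card_filter]
    push_cast
    exact Finset.sum_congr rfl fun i _ => by simp [Set.indicator_apply]
  rw [this]
  refine Finset.measurable_sum _ fun i _ => ?_
  exact (measurable_one.indicator hA).comp (measurable_pi_apply i)

theorem measurable_prod_fallingFactorial {Λ : Type*} [TopologicalSpace Λ] [MeasurableSpace Λ]
    {m : ℕ} {A : Fin m → Set Λ} (hA : ∀ i, MeasurableSet (A i)) (k : Fin m → ℕ) :
    Measurable fun X : Configuration Λ => ∏ i, fallingFactorial (X.count (A i)) (k i) := by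
  refine Finset.measurable_prod _ fun i _ => ?_
  exact Finset.measurable_prod _ fun j _ => (Configuration.measurable_count (hA i)).sub_const _

/-! ### The point field of a projection kernel -/

theorem measurableSet_forall_mem {Λ : Type*} [MeasurableSpace Λ] {m k : ℕ} {A : Fin m → Set Λ}
    (hA : ∀ i, MeasurableSet (A i)) (b : Fin k → Fin m) :
    MeasurableSet {x : Fin k → Λ | ∀ j, x j ∈ A (b j)} := by
  rw [Set.ofPred_forall]
  exact MeasurableSet.iInter fun j => measurable_pi_apply j (hA (b j))

/-- Both sides count the choices of `k` distinct labels whose points lie in the prescribed sets. The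
sum over embeddings can be integrated term by term. -/
theorem prod_fallingFactorial_pointConfiguration {Λ : Type*} [TopologicalSpace Λ] {m k n : ℕ}
    {A : Fin m → Set Λ} (hdisj : Pairwise (Function.onFun Disjoint A)) (b : Fin k → Fin m)
    (x : Fin n → Λ) : ∏ i, fallingFactorial ((pointConfiguration x).count (A i))
        (Finset.univ.filter fun j => b j = i).card =
      ∑ φ : Fin k ↪ Fin n, {y : Fin k → Λ | ∀ j, y j ∈ A (b j)}.indicator (fun _ => (1 : ℝ≥0∞)) (x ∘ φ) := by
  classical
  simp only [count_pointConfiguration, fallingFactorial_natCast]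
  have h := sum_embedding_eq_prod_descFactorial (fun (j : Fin n) i => x j ∈ A i)
    (fun j i i' h h' => by
      by_contra hne
      exact Set.disjoint_left.1 (hdisj hne) h h') b
  rw [← Nat.cast_prod]
  calc _ = ((∑ φ : Fin k ↪ Fin n, if ∀ l, x (φ l) ∈ A (b l) then 1 else 0 : ℕ) : ℝ≥0∞) := by
        rw [h]
        congr!
    _ = _ := by
        rw [Nat.cast_sum]
        refine Finset.sum_congr rfl fun φ _ => ?_
        simp [Set.indicator_apply]

/-- The law of the point field with kernel `K_I`: it has `#I` points with joint density
`R / (#I)!`. -/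
noncomputable def projField {Λ : Type*} [TopologicalSpace Λ] [MeasurableSpace Λ] (μ : Measure Λ)
    {r : ℕ} (u : Fin r → Λ → ℍ[ℂ]) (I : Finset (Fin r)) : Measure (Configuration Λ) :=
  ((Measure.pi fun _ : Fin I.card => μ).withDensity fun x =>
    (I.card.factorial : ℝ≥0∞)⁻¹ * projCorrelation u I I.card x).map pointConfiguration

theorem lintegral_projField {Λ : Type*} [TopologicalSpace Λ] [MeasurableSpace Λ] {μ : Measure Λ}
    {r : ℕ} {u : Fin r → Λ → ℍ[ℂ]} (hu : ∀ k, QMeasurable (u k)) (I : Finset (Fin r))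
    {F : Configuration Λ → ℝ≥0∞} (hF : Measurable F) : ∫⁻ X, F X ∂(projField μ u I) =
      (I.card.factorial : ℝ≥0∞)⁻¹ * ∫⁻ x, F (pointConfiguration x) *
        projCorrelation u I I.card x ∂(Measure.pi fun _ => μ) := by
  have h1 := (measurable_projCorrelation hu I I.card).coe_nnreal_ennreal
  have h2 : Measurable fun x : Fin I.card → Λ => F (pointConfiguration x) :=
    hF.comp measurable_pointConfiguration
  rw [projField, lintegral_map hF measurable_pointConfiguration,
    lintegral_withDensity_eq_lintegral_mul _ (h1.const_mul _) h2,
    ← lintegral_const_mul (μ := Measure.pi fun _ : Fin I.card => μ)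
      (f := fun x => F (pointConfiguration x) * projCorrelation u I I.card x) _ (h2.mul h1)]
  refine lintegral_congr fun x => ?_
  simp only [Pi.mul_apply]
  ring

/-- All coordinates are integrated out: the case of the embedding of `Fin 0`. -/
theorem lintegral_projCorrelation {Λ : Type*} [MeasurableSpace Λ] {μ : Measure Λ} [SigmaFinite μ]
    {r : ℕ} {u : Fin r → Λ → ℍ[ℂ]} (hu : IsOrthonormalSystem μ u) (hpos : IsCompletelyPositive u)
    (I : Finset (Fin r)) (m : ℕ) :
    ∫⁻ x, projCorrelation u I m x ∂(Measure.pi fun _ => μ) = (I.card.descFactorial m : ℝ≥0∞) := by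
  have h := lintegral_comp_embedding_mul hu hpos I (k := 0) (n := m)
    ⟨fun i => i.elim0, fun i => i.elim0⟩ (g := fun _ => 1) measurable_const
  have h0 : ∀ x : Fin 0 → Λ, projCorrelation u I 0 x = 1 := fun x => by
    rw [projCorrelation, detC, detM_zero_dim]
    simp
  simpa [h0] using h

theorem isProbabilityMeasure_projField {Λ : Type*} [TopologicalSpace Λ] [MeasurableSpace Λ]
    {μ : Measure Λ} [SigmaFinite μ] {r : ℕ} {u : Fin r → Λ → ℍ[ℂ]} (hu : IsOrthonormalSystem μ u)
    (hpos : IsCompletelyPositive u) (I : Finset (Fin r)) :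
    IsProbabilityMeasure (projField μ u I) := by
  constructor
  rw [← lintegral_one, lintegral_projField hu.measurable I measurable_const]
  simp only [one_mul]
  rw [lintegral_projCorrelation hu hpos, Nat.descFactorial_self]
  exact ENNReal.inv_mul_cancel (by exact_mod_cast I.card.factorial_ne_zero)
    (ENNReal.natCast_ne_top _)

theorem integrable_projCorrelation {Λ : Type*} [MeasurableSpace Λ] {μ : Measure Λ} [SigmaFinite μ]
    {r : ℕ} {u : Fin r → Λ → ℍ[ℂ]} (hu : IsOrthonormalSystem μ u) (hpos : IsCompletelyPositive u)
    (I : Finset (Fin r)) (m : ℕ) :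
    Integrable (fun x => (projCorrelation u I m x : ℝ)) (Measure.pi fun _ => μ) := by
  refine ⟨(measurable_projCorrelation hu.measurable I m).coe_nnreal_real.aestronglyMeasurable, ?_⟩
  rw [hasFiniteIntegral_iff_enorm]
  have : ∀ x : Fin m → Λ, ‖(projCorrelation u I m x : ℝ)‖ₑ = projCorrelation u I m x := fun x => by
    rw [Real.enorm_of_nonneg (NNReal.coe_nonneg _), ENNReal.ofReal_coe_nnreal]
  simp only [this, lintegral_projCorrelation hu hpos]
  exact ENNReal.natCast_lt_top _

theorem isCorrelationFunction_projCorrelation {Λ : Type*} [TopologicalSpace Λ] [MeasurableSpace Λ]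
    {μ : Measure Λ} [SigmaFinite μ] {r : ℕ} {u : Fin r → Λ → ℍ[ℂ]} (hu : IsOrthonormalSystem μ u)
    (hpos : IsCompletelyPositive u) (I : Finset (Fin r)) (k : ℕ) :
    IsCorrelationFunction (projField μ u I) μ k (projCorrelation u I k) where
  aemeasurable := (measurable_projCorrelation hu.measurable I k).aemeasurable
  locallyIntegrable := (integrable_projCorrelation hu hpos I k).locallyIntegrable
  moments m A hA hdisj b _ := by
    set S : Set (Fin k → Λ) := {x | ∀ j, x j ∈ A (b j)} with hS
    have hSm : MeasurableSet S := measurableSet_forall_mem hA b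
    have hg : Measurable (S.indicator fun _ => (1 : ℝ≥0∞)) := measurable_const.indicator hSm
    have hR : ∀ n, Measurable fun x : Fin n → Λ => (projCorrelation u I n x : ℝ≥0∞) := fun n =>
      (measurable_projCorrelation hu.measurable I n).coe_nnreal_ennreal
    rw [lintegral_projField hu.measurable I (measurable_prod_fallingFactorial hA _)]
    simp only [prod_fallingFactorial_pointConfiguration hdisj, ← hS, Finset.sum_mul]
    have hterm : ∀ φ : Fin k ↪ Fin I.card, Measurable fun x : Fin I.card → Λ =>
        S.indicator (fun _ => (1 : ℝ≥0∞)) (x ∘ φ) * projCorrelation u I I.card x := fun φ =>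
      (hg.comp (measurable_pi_lambda _ fun i => measurable_pi_apply (φ i))).mul (hR _)
    rw [lintegral_finsetSum _ fun φ _ => hterm φ]
    simp only [lintegral_comp_embedding_mul hu hpos I _ hg]
    have hint : ∫⁻ x, S.indicator (fun _ => 1) x * projCorrelation u I k x ∂(Measure.pi fun _ => μ) =
        ∫⁻ x in S, projCorrelation u I k x ∂(Measure.pi fun _ => μ) := by
      rw [← lintegral_indicator hSm]
      refine lintegral_congr fun x => ?_
      by_cases hx : x ∈ S <;> simp [hx]
    rw [hint, Finset.sum_const, Finset.card_univ, Fintype.card_embedding_eq, Fintype.card_fin,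
      Fintype.card_fin, nsmul_eq_mul, Nat.descFactorial_self, ← mul_assoc, ← mul_assoc]
    -- Each of the `#I! / (#I - k)!` embeddings contributes `(#I - k)!` times the integral, and
    -- `#I!` cancels the normalization. For `k > #I` both sides vanish.
    rcases le_or_gt k I.card with hk | hk
    · rw [mul_assoc (_⁻¹), ← Nat.cast_mul, mul_comm (I.card.descFactorial k),
        Nat.factorial_mul_descFactorial hk, ENNReal.inv_mul_cancel
          (by exact_mod_cast I.card.factorial_ne_zero) (ENNReal.natCast_ne_top _), one_mul]
    · simp [projCorrelation_eq_zero hu hpos I hk]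

theorem isPfaffianField_projField {Λ : Type*} [TopologicalSpace Λ] [MeasurableSpace Λ]
    {μ : Measure Λ} [SigmaFinite μ] {r : ℕ} {u : Fin r → Λ → ℍ[ℂ]} (hu : IsOrthonormalSystem μ u)
    (hpos : IsCompletelyPositive u) (I : Finset (Fin r)) :
    IsPfaffianField (projField μ u I) μ (projKernel u I) where
  isProbabilityMeasure := isProbabilityMeasure_projField hu hpos I
  selfDual x y := by simp [projKernel]
  correlation m _ := ⟨projCorrelation u I m, isCorrelationFunction_projCorrelation hu hpos I m,
    fun x => ofRealQ_projCorrelation hpos I x⟩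

/-! ### The random set of occupied indices -/

open scoped Classical in
/-- The indices `k` with `ξ_k = 1`. -/
noncomputable def occupied {Ω : Type*} {r : ℕ} (ξ : Fin r → Ω → ℝ) (ω : Ω) : Finset (Fin r) :=
  Finset.univ.filter fun k => ξ k ω = 1

theorem occupied_preimage {Ω : Type*} {r : ℕ} (ξ : Fin r → Ω → ℝ) (J : Finset (Fin r)) :
    {ω | occupied ξ ω = J} = ⋂ k ∈ Finset.univ, ξ k ⁻¹' (if k ∈ J then {1} else {1}ᶜ) := by
  ext ω
  simp only [Set.mem_ofPred_eq, Finset.ext_iff, occupied, Finset.mem_filter, Finset.mem_univ,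
    true_and, Set.mem_iInter, Set.mem_preimage, forall_true_left]
  refine forall_congr' fun k => ?_
  by_cases hk : k ∈ J <;> simp [hk]

theorem measurableSet_occupied {Ω : Type*} [MeasurableSpace Ω] {r : ℕ} {ξ : Fin r → Ω → ℝ}
    (hξ : ∀ k, Measurable (ξ k)) (J : Finset (Fin r)) : MeasurableSet {ω | occupied ξ ω = J} := by
  rw [occupied_preimage]
  refine MeasurableSet.biInter (Set.to_countable _) fun k _ => hξ k ?_
  split_ifs
  · exact measurableSet_singleton _
  · exact (measurableSet_singleton _).compl

/-- The probability that exactly the indices in `J` are occupied. -/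
noncomputable def occupationWeight {r : ℕ} (c : Fin r → ℝ) (J : Finset (Fin r)) : ℝ≥0 :=
  (∏ k ∈ J, (c k).toNNReal) * ∏ k ∈ Jᶜ, (1 - c k).toNNReal

theorem measure_occupied {Ω : Type*} [MeasurableSpace Ω] {ν : Measure Ω} [IsProbabilityMeasure ν]
    {r : ℕ} {c : Fin r → ℝ} (hc : ∀ k, c k ∈ Set.Icc (0 : ℝ) 1) {ξ : Fin r → Ω → ℝ}
    (hξ : IsBernoulliFamily ν c ξ) (J : Finset (Fin r)) :
    ν {ω | occupied ξ ω = J} = occupationWeight c J := by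
  rw [occupied_preimage, hξ.indep.measure_inter_preimage_eq_mul Finset.univ]
  · have h1 : ∀ k ∈ J, ν (ξ k ⁻¹' (if k ∈ J then {1} else {1}ᶜ)) = ((c k).toNNReal : ℝ≥0∞) := by
      intro k hk
      rw [if_pos hk]
      exact hξ.prob_one k
    have h2 : ∀ k ∈ Jᶜ, ν (ξ k ⁻¹' (if k ∈ J then {1} else {1}ᶜ)) =
        ((1 - c k).toNNReal : ℝ≥0∞) := by
      intro k hk
      rw [if_neg (Finset.mem_compl.1 hk), Set.preimage_compl,
        prob_compl_eq_one_sub (hξ.measurable k (measurableSet_singleton _)),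
        show ν (ξ k ⁻¹' {1}) = ENNReal.ofReal (c k) from hξ.prob_one k]
      change _ = ENNReal.ofReal (1 - c k)
      rw [ENNReal.ofReal_sub _ (hc k).1, ENNReal.ofReal_one]
    rw [← Finset.prod_mul_prod_compl J, Finset.prod_congr rfl h1, Finset.prod_congr rfl h2,
      occupationWeight]
    push_cast
    rfl
  · intro k _
    split_ifs
    · exact measurableSet_singleton _
    · exact (measurableSet_singleton _).compl

theorem ae_eq_zero_or_one {Ω : Type*} [MeasurableSpace Ω] {ν : Measure Ω} [IsProbabilityMeasure ν]
    {r : ℕ} {c : Fin r → ℝ} (hc : ∀ k, c k ∈ Set.Icc (0 : ℝ) 1) {ξ : Fin r → Ω → ℝ}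
    (hξ : IsBernoulliFamily ν c ξ) : ∀ᵐ ω ∂ν, ∀ k, ξ k ω = 1 ∨ ξ k ω = 0 := by
  rw [ae_all_iff]
  intro k
  have h1 : MeasurableSet {ω | ξ k ω = 1} := hξ.measurable k (measurableSet_singleton _)
  have h0 : MeasurableSet {ω | ξ k ω = 0} := hξ.measurable k (measurableSet_singleton _)
  have hd : Disjoint {ω | ξ k ω = 1} {ω | ξ k ω = 0} := by
    rw [Set.disjoint_left]
    intro ω h h'
    simp only [Set.mem_ofPred_eq] at h h'
    rw [h] at h'
    exact one_ne_zero h'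
  have : ν ({ω | ξ k ω = 1} ∪ {ω | ξ k ω = 0}) = 1 := by
    rw [measure_union hd h0, hξ.prob_one, hξ.prob_zero,
      ← ENNReal.ofReal_add (hc k).1 (sub_nonneg.2 (hc k).2)]
    simp
  exact (mem_ae_iff_prob_eq_one (h1.union h0)).2 this

theorem diagKernel_eq_projKernel {Λ Ω : Type*} {r : ℕ} (u : Fin r → Λ → ℍ[ℂ]) {ξ : Fin r → Ω → ℝ}
    {ω : Ω} (h : ∀ k, ξ k ω = 1 ∨ ξ k ω = 0) :
    diagKernel (fun k => ξ k ω) u = projKernel u (occupied ξ ω) := by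
  classical
  funext x y
  rw [diagKernel, projKernel, occupied, Finset.sum_filter]
  refine Finset.sum_congr rfl fun k _ => ?_
  rcases h k with hk | hk <;> simp [hk, ofRealQ]

theorem exists_kernel_projField {Λ Ω : Type*} [TopologicalSpace Λ] [MeasurableSpace Λ]
    [MeasurableSpace Ω] (μ : Measure Λ) {r : ℕ} (u : Fin r → Λ → ℍ[ℂ]) {ξ : Fin r → Ω → ℝ}
    (hξ : ∀ k, Measurable (ξ k)) :
    ∃ κ : Kernel Ω (Configuration Λ), ∀ ω, κ ω = projField μ u (occupied ξ ω) := by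
  -- The law depends on `ω` only through a finite discrete set, so its measurability is that of
  -- `occupied ξ`.
  let _ : MeasurableSpace (Finset (Fin r)) := ⊤
  have hocc : Measurable (occupied ξ) := measurable_to_countable' fun J =>
    measurableSet_occupied hξ J
  have hfield : Measurable fun J : Finset (Fin r) => projField μ u J := measurable_from_top
  exact ⟨⟨fun ω => projField μ u (occupied ξ ω), hfield.comp hocc⟩, fun _ => rfl⟩

theorem lintegral_comp_occupied {Ω : Type*} [MeasurableSpace Ω] {ν : Measure Ω}
    [IsProbabilityMeasure ν] {r : ℕ} {c : Fin r → ℝ} (hc : ∀ k, c k ∈ Set.Icc (0 : ℝ) 1)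
    {ξ : Fin r → Ω → ℝ} (hξ : IsBernoulliFamily ν c ξ) (G : Finset (Fin r) → ℝ≥0∞) :
    ∫⁻ ω, G (occupied ξ ω) ∂ν = ∑ J, occupationWeight c J * G J := by
  let _ : MeasurableSpace (Finset (Fin r)) := ⊤
  have hocc : Measurable (occupied ξ) := measurable_to_countable' fun J =>
    measurableSet_occupied hξ.measurable J
  rw [← lintegral_map (f := G) measurable_from_top hocc, lintegral_fintype]
  refine Finset.sum_congr rfl fun J _ => ?_
  rw [Measure.map_apply hocc trivial, mul_comm]
  congr 1
  exact measure_occupied hc hξ J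

/-! ### The mixture -/

theorem ofRealQ_injective : Function.Injective ofRealQ := by
  intro a b h
  have := congrArg (fun q : ℍ[ℂ] => reLinear q) h
  exact Complex.ofReal_injective this

/-- The correlation function of the mixture. -/
noncomputable def mixedCorrelation {Λ : Type*} {r : ℕ} (c : Fin r → ℝ) (u : Fin r → Λ → ℍ[ℂ])
    (m : ℕ) (x : Fin m → Λ) : ℝ≥0 :=
  ∑ J, occupationWeight c J * projCorrelation u J m x

/-- The interpolation formula `detC_sum_smul_outer`, with `v_k` the values of `u_k` at the points of
`x`. -/
theorem ofRealQ_mixedCorrelation {Λ : Type*} {r : ℕ} {c : Fin r → ℝ}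
    (hc : ∀ k, c k ∈ Set.Icc (0 : ℝ) 1) {u : Fin r → Λ → ℍ[ℂ]} (hpos : IsCompletelyPositive u)
    {m : ℕ} (x : Fin m → Λ) : ofRealQ (mixedCorrelation c u m x) =
      detM (kernelMatrix (diagKernel c u) x) := by
  have hmat : kernelMatrix (diagKernel c u) x =
      ∑ k, (c k : ℂ) • outer (fun i => u k (x i)) (fun i => u k (x i)) := by
    ext1 i j
    simp only [kernelMatrix, diagKernel, outer, ofRealQ, Matrix.of_apply, Matrix.sum_apply,
      Matrix.smul_apply, coe_mul_eq_smul]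
  have hsd : IsSelfDual (kernelMatrix (diagKernel c u) x) := by
    intro i j
    simp only [kernelMatrix, diagKernel, ofRealQ, Matrix.of_apply, coe_mul_eq_smul, star_sum,
      star_smul_complex, star_mul, star_star]
  rw [detM_eq_coe_re hsd, ofRealQ]
  congr 1
  change _ = detC _
  rw [hmat, detC_sum_smul_outer, mixedCorrelation]
  push_cast
  refine Finset.sum_congr rfl fun J _ => ?_
  rw [coe_projCorrelation hpos, kernelMatrix_projKernel]
  congr 1
  rw [occupationWeight]
  push_cast
  congr 1
  · refine Finset.prod_congr rfl fun k _ => ?_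
    exact congrArg _ (Real.coe_toNNReal _ (hc k).1)
  · refine Finset.prod_congr rfl fun k _ => ?_
    rw [Real.coe_toNNReal _ (sub_nonneg.2 (hc k).2)]
    push_cast
    rfl

/-- Conditioning on `ω` averages the factorial moments. This uses only that `κ ω` is almost surely
Pfaffian, not how it was constructed. -/
theorem isPfaffianField_bind {Λ Ω : Type*} [TopologicalSpace Λ] [MeasurableSpace Λ]
    [MeasurableSpace Ω] {μ : Measure Λ} [SigmaFinite μ] {r : ℕ} {c : Fin r → ℝ}
    {u : Fin r → Λ → ℍ[ℂ]} (hu : IsOrthonormalSystem μ u) (hpos : IsCompletelyPositive u)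
    (hc : ∀ k, c k ∈ Set.Icc (0 : ℝ) 1) {ν : Measure Ω} [IsProbabilityMeasure ν]
    {ξ : Fin r → Ω → ℝ} (hξ : IsBernoulliFamily ν c ξ) {κ : Kernel Ω (Configuration Λ)}
    (hκ : IsPfaffianMixture μ ν u ξ κ) : IsPfaffianField (ν.bind κ) μ (diagKernel c u) where
  isProbabilityMeasure := by
    constructor
    rw [Measure.bind_apply MeasurableSet.univ κ.measurable.aemeasurable]
    have : ∀ᵐ ω ∂ν, κ ω Set.univ = 1 := by
      filter_upwards [hκ] with ω hω
      exact hω.isProbabilityMeasure.measure_univ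
    rw [lintegral_congr_ae this]
    simp
  selfDual x y := by
    simp only [diagKernel, ofRealQ, coe_mul_eq_smul, star_sum, star_smul_complex, star_mul,
      star_star]
  correlation m hm := by
    refine ⟨mixedCorrelation c u m, ⟨?_, ?_, ?_⟩, fun x => ofRealQ_mixedCorrelation hc hpos x⟩
    · exact (Finset.measurable_sum _ fun J _ =>
        (measurable_projCorrelation hu.measurable J m).const_mul _).aemeasurable
    · have : (fun x : Fin m → Λ => (mixedCorrelation c u m x : ℝ)) = fun x =>
          ∑ J, (occupationWeight c J : ℝ) * projCorrelation u J m x := by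
        funext x
        simp [mixedCorrelation]
      rw [this]
      exact (integrable_finsetSum _ fun J _ =>
        (integrable_projCorrelation hu hpos J m).const_mul _).locallyIntegrable
    · intro p A hA hdisj b hb
      rw [Measure.lintegral_bind κ.measurable.aemeasurable
        (measurable_prod_fallingFactorial hA _).aemeasurable]
      have hae : ∀ᵐ ω ∂ν, ∫⁻ X, ∏ i, fallingFactorial (X.count (A i))
          (Finset.univ.filter fun j => b j = i).card ∂(κ ω) =
          ∫⁻ x in {x : Fin m → Λ | ∀ j, x j ∈ A (b j)}, projCorrelation u (occupied ξ ω) m x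
            ∂(Measure.pi fun _ => μ) := by
        filter_upwards [hκ, ae_eq_zero_or_one hc hξ] with ω hω h01
        obtain ⟨R, hR, hdet⟩ := hω.correlation m hm
        -- The determinant fixes the correlation function at every point, so any choice of `κ` has
        -- the same conditional moments.
        have hRe : R = projCorrelation u (occupied ξ ω) m := by
          funext x
          have h := hdet x
          rw [diagKernel_eq_projKernel u h01, ← ofRealQ_projCorrelation hpos] at h
          exact NNReal.coe_injective (ofRealQ_injective h)
        rw [hR.moments p A hA hdisj b hb, hRe]
      rw [lintegral_congr_ae hae, lintegral_comp_occupied hc hξ fun J =>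
        ∫⁻ x in {x : Fin m → Λ | ∀ j, x j ∈ A (b j)}, projCorrelation u J m x
            ∂(Measure.pi fun _ => μ)]
      simp only [mixedCorrelation, ENNReal.ofNNReal_finsetSum, ENNReal.coe_mul]
      have hmeas : ∀ J, Measurable fun x : Fin m → Λ => (projCorrelation u J m x : ℝ≥0∞) :=
        fun J => (measurable_projCorrelation hu.measurable J m).coe_nnreal_ennreal
      rw [lintegral_finsetSum _ fun J _ => (hmeas J).const_mul _]
      exact Finset.sum_congr rfl fun J _ => (lintegral_const_mul _ (hmeas J)).symm

end Pfaffian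

theorem theorem4 {Λ Ω : Type*} [TopologicalSpace Λ] [MeasurableSpace Λ] [MeasurableSpace Ω]
    (μ : MeasureTheory.Measure Λ) [MeasureTheory.SigmaFinite μ]
    (K : Λ → Λ → Quaternion ℂ) {r : ℕ} (c : Fin r → ℝ) (u : Fin r → Λ → Quaternion ℂ)
    (hK : Pfaffian.HasQuasiRealForm μ K c u)
    (hpos : Pfaffian.IsCompletelyPositive u)
    (hc : ∀ k, c k ∈ Set.Icc (0 : ℝ) 1)
    (ν : MeasureTheory.Measure Ω) [MeasureTheory.IsProbabilityMeasure ν]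
    (ξ : Fin r → Ω → ℝ) (hξ : Pfaffian.IsBernoulliFamily ν c ξ) :
    (∃ κ : ProbabilityTheory.Kernel Ω (Pfaffian.Configuration Λ),
      Pfaffian.IsPfaffianMixture μ ν u ξ κ) ∧
    ∀ κ : ProbabilityTheory.Kernel Ω (Pfaffian.Configuration Λ),
      Pfaffian.IsPfaffianMixture μ ν u ξ κ →
        Pfaffian.IsPfaffianField (ν.bind κ) μ K := by
  constructor
  · obtain ⟨κ, hκ⟩ := Pfaffian.exists_kernel_projField μ u hξ.measurable
    refine ⟨κ, ?_⟩
    filter_upwards [Pfaffian.ae_eq_zero_or_one hc hξ] with ω hω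
    rw [hκ, Pfaffian.diagKernel_eq_projKernel u hω]
    exact Pfaffian.isPfaffianField_projField hK.orthonormal hpos _
  · intro κ hκ
    rw [show K = Pfaffian.diagKernel c u from funext fun x => funext fun y => hK.eq_sum x y]
    exact Pfaffian.isPfaffianField_bind hK.orthonormal hpos hc hξ hκ
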